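/- Let $g \ge 1$ and let $F_{g,0}$ be the free group on $x_1,\dots,x_g,y_1,\dots,y_g$. Write $\overline u = u^{-1}$ and $[u,v] = \overline u\,\overline v\,u\,v$. Let $\mathrm{A}_{g,0}$ be the group of all automorphisms of $F_{g,0}$ that fix the element $[x_1,y_1][x_2,y_2]\cdots[x_g,y_g]$, and let $\mathrm{Stab}(\overline x_1\overline y_1x_1;\mathrm{A}_{g,0})$ be the subgroup of those elements of $\mathrm{A}_{g,0}$ that fix $\overline x_1\overline y_1x_1$. Let $\beta_1$ be the automorphism of $F_{g,0}$ that sends $y_1$ to $x_1y_1$ and fixes all the other basis elements. Then $\mathrm{A}_{g,0}$ is generated, as a group, by $\mathrm{Stab}(\overline x_1\overline y_1x_1;\mathrm{A}_{g,0})\cup\{\beta_1\}$. -/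

import Mathlib

namespace ZieschangMCG

/-- The distinguished basis of `F_{g,p}`: `t_1, …, t_p`, `x_1, …, x_g`, `y_1, …, y_g`
(indexed from `0` here). -/
inductive Gen (g p : ℕ) : Type
  | t (j : Fin p) : Gen g p
  | x (i : Fin g) : Gen g p
  | y (i : Fin g) : Gen g p
  deriving DecidableEq

/-- The free group `F_{g,p}` of rank `2g + p`. -/
abbrev F (g p : ℕ) : Type := FreeGroup (Gen g p)

/-- The basis element `t_j` of `F_{g,p}`. -/
def tt {g p : ℕ} (j : Fin p) : F g p := FreeGroup.of (Gen.t j)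

/-- The basis element `x_i` of `F_{g,p}`. -/
def xx {g p : ℕ} (i : Fin g) : F g p := FreeGroup.of (Gen.x i)

/-- The basis element `y_i` of `F_{g,p}`. -/
def yy {g p : ℕ} (i : Fin g) : F g p := FreeGroup.of (Gen.y i)

/-- The commutator with the convention `[u, v] = u⁻¹ v⁻¹ u v`. -/
def commBar {G : Type*} [Group G] (u v : G) : G := u⁻¹ * v⁻¹ * u * v

/-- The word `t_p ⋯ t_1 [x_1, y_1] ⋯ [x_g, y_g]`. -/
def surfaceWord (g p : ℕ) : F g p :=
  (List.ofFn fun j : Fin p => (tt j : F g p)).reverse.prod *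
    (List.ofFn fun i : Fin g => commBar (xx i : F g p) (yy i)).prod

/-- The set `{[t_1], …, [t_p]}` of conjugacy classes of `F_{g,p}`. -/
def tClasses (g p : ℕ) : Set (ConjClasses (F g p)) :=
  Set.range fun j : Fin p => ConjClasses.mk (tt j)

/-- The group `A_{g,p}` of the automorphisms of `F_{g,p}` that fix
`t_p ⋯ t_1 [x_1, y_1] ⋯ [x_g, y_g]` and permute the set `{[t_1], …, [t_p]}`. -/
def A (g p : ℕ) : Subgroup (MulAut (F g p)) where
  carrier := {φ | φ (surfaceWord g p) = surfaceWord g p ∧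
    ConjClasses.map φ.toMonoidHom '' tClasses g p = tClasses g p}
  one_mem' := by
    refine ⟨rfl, ?_⟩
    have h : ConjClasses.map (1 : MulAut (F g p)).toMonoidHom = id := by
      funext c
      induction c using Quotient.inductionOn
      rfl
    rw [h, Set.image_id]
  mul_mem' := by
    rintro φ ψ ⟨h₁, h₂⟩ ⟨k₁, k₂⟩
    refine ⟨by rw [MulAut.mul_apply, k₁, h₁], ?_⟩
    have h : ConjClasses.map (φ * ψ).toMonoidHom =
        ConjClasses.map φ.toMonoidHom ∘ ConjClasses.map ψ.toMonoidHom := by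
      funext c
      induction c using Quotient.inductionOn
      rfl
    rw [h, Set.image_comp, k₂, h₂]
  inv_mem' := by
    rintro φ ⟨h₁, h₂⟩
    refine ⟨?_, ?_⟩
    · conv_lhs => rw [← h₁]
      exact MulAut.inv_apply_self _ φ _
    have h : ConjClasses.map (φ⁻¹).toMonoidHom ∘ ConjClasses.map φ.toMonoidHom = id := by
      funext c
      induction c using Quotient.inductionOn with
      | h a => exact congrArg ConjClasses.mk (MulAut.inv_apply_self _ φ a)
    conv_lhs => rw [← h₂]
    rw [← Set.image_comp, h, Set.image_id]

/-- The endomorphism of `F_{g,p}` that sends `y_i` to `u * y_i` and fixes every other basis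
element. -/
def mulY {g p : ℕ} (i : Fin g) (u : F g p) : F g p →* F g p :=
  FreeGroup.lift fun b => if b = Gen.y i then u * yy i else FreeGroup.of b

/-- The automorphism `β_i` of `F_{g,p}` that sends `y_i` to `x_i y_i` and fixes every other basis
element; its inverse sends `y_i` to `x_i⁻¹ y_i`. -/
def beta {g p : ℕ} (i : Fin g) : MulAut (F g p) :=
  MonoidHom.toMulEquiv (mulY i (xx i)) (mulY i (xx i)⁻¹)
    (by
      ext b
      by_cases h : b = Gen.y i
      · subst h; simp [mulY, xx, yy]
      · simp [mulY, h])
    (by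
      ext b
      by_cases h : b = Gen.y i
      · subst h; simp [mulY, xx, yy]
      · simp [mulY, h])

end ZieschangMCG

/-! Put z = x̄₁ȳ₁x₁ and let G be the subgroup generated by the stabilizer of z and β₁. Since G
contains the stabilizer, an element φ of A lies in G as soon as φ(z) is in the G-orbit of z. Some
element of G takes z to x̄₁ (`exists_apply_zz`), so it is enough that φ(x̄₁) lies in this orbit.

This is proved for more general objects, the states (V, φ) of `IsState`: the word V need not be the
surface word. If the values of two consecutive letters c, d of V cancel too much, a Nielsen move
replaces c or d by cd. Moving one letter of V to another place gives a state again, and the total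
length of the values drops, or stays the same while a rank drops. If no move applies, every value
contributes exactly one letter to the surface word, and the initial pattern a b ā b̄ forces the
first letter of V to have value x̄₁, which is in the orbit (`apply_head_of_isChain_tight`).

It remains to transport the property "the first letter has its value in the orbit" back along the
moves. This reduces to comparing φ(a) with φ(a)φ(b), where a, b are the first two letters
(`IsState.inOrbit_mul`). If V = a P ā Q, then φ(a) and φ(a P ā) are the images of x̄₁ and z under
one ψ ∈ A (`IsState.exists_mem_A`), so one is in the orbit iff the other is. The move a ↦ ab does
not change the value of this prefix, which links φ(a) to φ(a)φ(b).

The automorphism ψ comes from a normal form as in the classification of surfaces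
(`exists_aut_hasNF`). Degenerate forms are excluded because no automorphic image of the surface word
omits a basis element (`apply_surfaceWord_not_mem_off`), which is seen in the Heisenberg group. -/

namespace ZieschangMCG

/-! ### Signed letters and elementary automorphisms of free groups -/

section FreeGroupLetters

variable {α : Type*}

/-- The inverse of a signed letter. -/
def bar (l : α × Bool) : α × Bool := (l.1, !l.2)

@[simp] theorem bar_bar (l : α × Bool) : bar (bar l) = l := by simp [bar]

@[simp] theorem bar_fst (l : α × Bool) : (bar l).1 = l.1 := rfl

@[simp] theorem bar_ne (l : α × Bool) : bar l ≠ l := by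
  intro h
  have := congrArg Prod.snd h
  simp [bar] at this

theorem eq_or_eq_bar {l m : α × Bool} (h : l.1 = m.1) : l = m ∨ l = bar m := by
  obtain ⟨a, b⟩ := l
  obtain ⟨c, d⟩ := m
  cases b <;> cases d <;> simp_all [bar]

/-- The element of the free group given by a signed letter. -/
def lt (l : α × Bool) : FreeGroup α := FreeGroup.mk [l]

theorem lt_true (x : α) : lt (x, true) = FreeGroup.of x := rfl

theorem lt_false (x : α) : lt (x, false) = (FreeGroup.of x)⁻¹ := rfl

@[simp] theorem lt_bar (l : α × Bool) : lt (bar l) = (lt l)⁻¹ := by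
  obtain ⟨x, b⟩ := l
  cases b <;> simp [bar, lt_true, lt_false]

theorem mk_eq_prod (L : List (α × Bool)) : FreeGroup.mk L = (L.map lt).prod := by
  induction L with
  | nil => rfl
  | cons l L ih =>
    rw [List.map_cons, List.prod_cons, ← ih, lt, FreeGroup.mul_mk]
    rfl

/-- The subgroup generated by the basis elements outside `X`. -/
def off (X : Set α) : Subgroup (FreeGroup α) := Subgroup.closure (FreeGroup.of '' Xᶜ)

theorem of_mem_off {X : Set α} {x : α} (h : x ∉ X) : FreeGroup.of x ∈ off X :=
  Subgroup.subset_closure ⟨x, h, rfl⟩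

theorem lt_mem_off {X : Set α} {l : α × Bool} (h : l.1 ∉ X) : lt l ∈ off X := by
  obtain ⟨x, b⟩ := l
  cases b
  · exact inv_mem (of_mem_off h)
  · exact of_mem_off h

theorem off_anti {X Y : Set α} (h : X ⊆ Y) : off Y ≤ off X :=
  Subgroup.closure_mono (Set.image_mono (Set.compl_subset_compl.2 h))

/-- The endomorphism `f` fixes every basis element outside `X`. -/
def FixesOff (X : Set α) (f : MulAut (FreeGroup α)) : Prop :=
  ∀ y, y ∉ X → f (FreeGroup.of y) = FreeGroup.of y

theorem hom_apply_of_mem_off {X : Set α} {f : FreeGroup α →* FreeGroup α}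
    (hf : ∀ y, y ∉ X → f (FreeGroup.of y) = FreeGroup.of y) {u : FreeGroup α} (hu : u ∈ off X) :
    f u = u := by
  have : off X ≤ f.eqLocus (MonoidHom.id _) := by
    rw [off, Subgroup.closure_le]
    rintro _ ⟨y, hy, rfl⟩
    exact hf y hy
  exact this hu

theorem FixesOff.apply_of_mem {X : Set α} {f : MulAut (FreeGroup α)} (hf : FixesOff X f)
    {u : FreeGroup α} (hu : u ∈ off X) : f u = u :=
  hom_apply_of_mem_off (f := f.toMonoidHom) hf hu

theorem FixesOff.mono {X Y : Set α} {f : MulAut (FreeGroup α)} (hf : FixesOff X f) (h : X ⊆ Y) :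
    FixesOff Y f := fun y hy => hf y fun hx => hy (h hx)

theorem FixesOff.mul {X : Set α} {f k : MulAut (FreeGroup α)} (hf : FixesOff X f)
    (hk : FixesOff X k) : FixesOff X (f * k) := fun y hy => by
  rw [MulAut.mul_apply, hk y hy, hf y hy]

/-- Multiplying the basis elements in `X` on both sides by elements of `off X` gives an
automorphism. -/
theorem exists_aut_mul_mul (X : Set α) (u v : α → FreeGroup α) (hu : ∀ y, u y ∈ off X)
    (hv : ∀ y, v y ∈ off X) :
    ∃ θ : MulAut (FreeGroup α), FixesOff X θ ∧
      ∀ y ∈ X, θ (FreeGroup.of y) = u y * FreeGroup.of y * v y := by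
  classical
  let T : (α → FreeGroup α) → (α → FreeGroup α) → FreeGroup α →* FreeGroup α := fun p q =>
    FreeGroup.lift fun y => if y ∈ X then p y * FreeGroup.of y * q y else FreeGroup.of y
  have hT : ∀ p q : α → FreeGroup α, ∀ w ∈ off X, T p q w = w := fun p q w hw =>
    hom_apply_of_mem_off (fun y hy => by simp [T, hy]) hw
  have key : ∀ p q : α → FreeGroup α, (∀ y, p y ∈ off X) → (∀ y, q y ∈ off X) →
      (T (fun y => (p y)⁻¹) fun y => (q y)⁻¹).comp (T p q) = MonoidHom.id _ := by
    intro p q hp hq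
    ext y
    by_cases hy : y ∈ X
    · have h1 : T p q (FreeGroup.of y) = p y * FreeGroup.of y * q y := by simp [T, hy]
      rw [MonoidHom.comp_apply, h1, map_mul, map_mul, hT _ _ _ (hp y), hT _ _ _ (hq y)]
      simp [T, hy, mul_assoc]
    · simp [T, hy]
  refine ⟨MonoidHom.toMulEquiv (T u v) (T (fun y => (u y)⁻¹) fun y => (v y)⁻¹) (key u v hu hv) ?_,
    ?_, ?_⟩
  · simpa using key (fun y => (u y)⁻¹) (fun y => (v y)⁻¹) (fun y => inv_mem (hu y))
      fun y => inv_mem (hv y)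
  · intro y hy
    simp [T, hy]
  · intro y hy
    simp [T, hy]

theorem apply_lt_of_apply_of {θ : MulAut (FreeGroup α)} {l : α × Bool} {u v : FreeGroup α}
    (h : θ (FreeGroup.of l.1) = (if l.2 then u else v⁻¹) * FreeGroup.of l.1 *
      (if l.2 then v else u⁻¹)) : θ (lt l) = u * lt l * v := by
  obtain ⟨x, b⟩ := l
  cases b
  · simp only [lt_false, map_inv]
    simp at h
    simp [h, mul_assoc]
  · simpa [lt_true] using h

/-- Multiplying a single letter on both sides. -/
theorem exists_aut_letter (l : α × Bool) {u v : FreeGroup α} (hu : u ∈ off {l.1})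
    (hv : v ∈ off {l.1}) :
    ∃ θ : MulAut (FreeGroup α), FixesOff {l.1} θ ∧ θ (lt l) = u * lt l * v := by
  obtain ⟨θ, h1, h2⟩ := exists_aut_mul_mul {l.1} (fun _ => if l.2 then u else v⁻¹)
    (fun _ => if l.2 then v else u⁻¹) (fun _ => by split_ifs; exacts [hu, inv_mem hv])
    (fun _ => by split_ifs; exacts [hv, inv_mem hu])
  exact ⟨θ, h1, apply_lt_of_apply_of (h2 _ rfl)⟩

/-- Multiplying two letters on both sides. -/
theorem exists_aut_two_letters {d e : α × Bool} (hde : d.1 ≠ e.1) {u v u' v' : FreeGroup α}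
    (hu : u ∈ off {d.1, e.1}) (hv : v ∈ off {d.1, e.1}) (hu' : u' ∈ off {d.1, e.1})
    (hv' : v' ∈ off {d.1, e.1}) :
    ∃ θ : MulAut (FreeGroup α), FixesOff {d.1, e.1} θ ∧ θ (lt d) = u * lt d * v ∧
      θ (lt e) = u' * lt e * v' := by
  classical
  obtain ⟨θ, h1, h2⟩ := exists_aut_mul_mul {d.1, e.1}
    (fun y => if y = d.1 then (if d.2 then u else v⁻¹) else (if e.2 then u' else v'⁻¹))
    (fun y => if y = d.1 then (if d.2 then v else u⁻¹) else (if e.2 then v' else u'⁻¹))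
    (fun _ => by split_ifs; exacts [hu, inv_mem hv, hu', inv_mem hv'])
    (fun _ => by split_ifs; exacts [hv, inv_mem hu, hv', inv_mem hu'])
  refine ⟨θ, h1, apply_lt_of_apply_of ?_, apply_lt_of_apply_of ?_⟩
  · simpa using h2 d.1 (by simp)
  · simpa [hde.symm] using h2 e.1 (by simp)

/-- Conjugating the basis elements in `Y`. -/
theorem exists_aut_conj (Y : Set α) {c : FreeGroup α} (hc : c ∈ off Y) :
    ∃ θ : MulAut (FreeGroup α), FixesOff Y θ ∧
      ∀ l : α × Bool, l.1 ∈ Y → θ (lt l) = c⁻¹ * lt l * c := by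
  obtain ⟨θ, h1, h2⟩ := exists_aut_mul_mul Y (fun _ => c⁻¹) (fun _ => c) (fun _ => inv_mem hc)
    (fun _ => hc)
  refine ⟨θ, h1, fun l hl => apply_lt_of_apply_of ?_⟩
  simpa using h2 l.1 hl

theorem FixesOff.apply_lt {X : Set α} {f : MulAut (FreeGroup α)} (hf : FixesOff X f)
    {l : α × Bool} (hl : l.1 ∉ X) : f (lt l) = lt l :=
  hf.apply_of_mem (lt_mem_off hl)

/-- The value of a word with letters, and with one constant `K` written as `none`. -/
def ev (K : FreeGroup α) (o : Option (α × Bool)) : FreeGroup α := o.elim K lt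

/-- The value of a word over letters and the constant `K`. -/
def val (K : FreeGroup α) (L : List (Option (α × Bool))) : FreeGroup α := (L.map (ev K)).prod

@[simp] theorem val_nil (K : FreeGroup α) : val K [] = 1 := rfl

@[simp] theorem val_cons (K : FreeGroup α) (o : Option (α × Bool)) (L : List _) :
    val K (o :: L) = ev K o * val K L := by simp [val]

@[simp] theorem val_append (K : FreeGroup α) (L M : List (Option (α × Bool))) :
    val K (L ++ M) = val K L * val K M := by simp [val]

@[simp] theorem ev_some (K : FreeGroup α) (l : α × Bool) : ev K (some l) = lt l := rfl

@[simp] theorem ev_none (K : FreeGroup α) : ev K none = K := rfl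

theorem val_mem_off {X : Set α} {K : FreeGroup α} {L : List (Option (α × Bool))} (hK : K ∈ off X)
    (h : ∀ l, some l ∈ L → l.1 ∉ X) : val K L ∈ off X := by
  refine Subgroup.list_prod_mem _ fun w hw => ?_
  obtain ⟨o, ho, rfl⟩ := List.mem_map.1 hw
  cases o with
  | none => exact hK
  | some l => exact lt_mem_off (h l ho)

/-- A product of commutators of letters. -/
def commProd (P : List ((α × Bool) × (α × Bool))) : FreeGroup α :=
  (P.map fun p => commBar (lt p.1) (lt p.2)).prod

/-- The letters occurring in a list of pairs. -/
def pairNames (P : List ((α × Bool) × (α × Bool))) : List α := P.flatMap fun p => [p.1.1, p.2.1]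

theorem commProd_mem_off {X : Set α} {P : List ((α × Bool) × (α × Bool))}
    (h : ∀ x ∈ pairNames P, x ∉ X) : commProd P ∈ off X := by
  refine Subgroup.list_prod_mem _ fun w hw => ?_
  obtain ⟨p, hp, rfl⟩ := List.mem_map.1 hw
  have h1 : lt p.1 ∈ off X := lt_mem_off (h _ (List.mem_flatMap.2 ⟨p, hp, by simp⟩))
  have h2 : lt p.2 ∈ off X := lt_mem_off (h _ (List.mem_flatMap.2 ⟨p, hp, by simp⟩))
  exact mul_mem (mul_mem (mul_mem (inv_mem h1) (inv_mem h2)) h1) h2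

/-- Collecting a handle: `A d B e C d⁻¹ D e⁻¹ E` becomes `A D C B E` times a commutator. -/
theorem exists_aut_handle {d e : α × Bool} (hde : d.1 ≠ e.1) {A B C D E : FreeGroup α}
    (hA : A ∈ off {d.1, e.1}) (hB : B ∈ off {d.1, e.1}) (hC : C ∈ off {d.1, e.1})
    (hD : D ∈ off {d.1, e.1}) (hE : E ∈ off {d.1, e.1}) :
    ∃ θ : MulAut (FreeGroup α), FixesOff {d.1, e.1} θ ∧
      θ (A * lt d * B * lt e * C * lt (bar d) * D * lt (bar e) * E) =
        A * D * C * B * E * commBar (lt (bar d)) (lt (bar e)) := by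
  -- The factors are chosen so that B, C, D, E cancel where they stand and reappear in front of d e
  -- d⁻¹ e⁻¹ as D C B E.
  obtain ⟨θ, h, hd, he⟩ := exists_aut_two_letters hde
    (u := D * C * B * E) (v := E⁻¹ * B⁻¹) (u' := E) (v' := E⁻¹ * B⁻¹ * C⁻¹)
    (mul_mem (mul_mem (mul_mem hD hC) hB) hE) (mul_mem (inv_mem hE) (inv_mem hB)) hE
    (mul_mem (mul_mem (inv_mem hE) (inv_mem hB)) (inv_mem hC))
  refine ⟨θ, h, ?_⟩
  simp only [map_mul, lt_bar, map_inv, hd, he, h.apply_of_mem hA, h.apply_of_mem hB,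
    h.apply_of_mem hC, h.apply_of_mem hD, h.apply_of_mem hE, commBar]
  group

end FreeGroupLetters

/-! ### Normal form of words in which each signed letter occurs once -/

section NormalForm

variable {α : Type*}

/-- The list `L` contains every signed letter over `X` exactly once and the constant `none` exactly
once. -/
structure IsWord (X : Finset α) (L : List (Option (α × Bool))) : Prop where
  nodup : L.Nodup
  none_mem : none ∈ L
  some_mem : ∀ l, some l ∈ L ↔ l.1 ∈ X

/-- `u` has the normal form `w K w⁻¹ ∏ [d, e]`, where `w` is trivial or a letter, and all the letters
that occur are distinct and in `X`. -/
def HasNF (X : Finset α) (K u : FreeGroup α) : Prop :=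
  ∃ (w : Option (α × Bool)) (P : List ((α × Bool) × (α × Bool))),
    ((w.map Prod.fst).toList ++ pairNames P).Nodup ∧
    (∀ x ∈ (w.map Prod.fst).toList ++ pairNames P, x ∈ X) ∧
    u = ev 1 w * K * (ev 1 w)⁻¹ * commProd P

theorem exists_split_of_mem_bar {L : List (Option (α × Bool))} {l : α × Bool}
    (h : some l ∈ L) (h' : some (bar l) ∈ L) :
    ∃ m, m.1 = l.1 ∧ ∃ A B C, L = A ++ some m :: (B ++ some (bar m) :: C) := by
  obtain ⟨A, R, rfl⟩ := List.append_of_mem h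
  have hne : some (bar l) ≠ some l := by simp
  rcases List.mem_append.1 h' with h1 | h1
  · obtain ⟨A1, A2, rfl⟩ := List.append_of_mem h1
    exact ⟨bar l, rfl, A1, A2, R, by simp⟩
  · obtain ⟨A1, A2, rfl⟩ := List.append_of_mem ((List.mem_cons.1 h1).resolve_left hne)
    exact ⟨l, rfl, A, A1, A2, rfl⟩

theorem nodup_handle {β : Type*} {A B C D E : List β} {d f d' f' : β}
    (h : (A ++ d :: (B ++ f :: (C ++ d' :: (D ++ f' :: E)))).Nodup) :
    (A ++ D ++ C ++ B ++ E).Nodup ∧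
      ∀ o ∈ A ++ D ++ C ++ B ++ E, o ≠ d ∧ o ≠ f ∧ o ≠ d' ∧ o ≠ f' := by
  have hp : (A ++ d :: (B ++ f :: (C ++ d' :: (D ++ f' :: E)))).Perm
      (d :: f :: d' :: f' :: (A ++ D ++ C ++ B ++ E)) := by
    classical
    rw [List.perm_iff_count]
    intro a
    simp only [List.count_append, List.count_cons]
    omega
  rw [hp.nodup_iff] at h
  simp only [List.nodup_cons, List.mem_cons, not_or] at h
  obtain ⟨⟨-, -, -, h1⟩, ⟨-, -, h2⟩, ⟨-, h3⟩, h4, h5⟩ := h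
  refine ⟨h5, fun o ho => ⟨?_, ?_, ?_, ?_⟩⟩ <;> rintro rfl <;> contradiction

theorem nodup_collapse {β : Type*} {A B C : List β} {m m' : β}
    (h : (A ++ m :: (B ++ m' :: C)).Nodup) :
    (A ++ B ++ C).Nodup ∧ (∀ o ∈ A ++ B ++ C, o ≠ m ∧ o ≠ m') ∧ ∀ o ∈ B, o ∉ A ∧ o ∉ C := by
  have hp : (A ++ m :: (B ++ m' :: C)).Perm (m :: m' :: (B ++ (A ++ C))) := by
    classical
    rw [List.perm_iff_count]
    intro a
    simp only [List.count_append, List.count_cons]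
    omega
  have hq : (A ++ B ++ C).Perm (B ++ (A ++ C)) := by
    rw [← List.append_assoc]
    exact List.perm_append_comm.append_right C
  rw [hp.nodup_iff] at h
  simp only [List.nodup_cons, List.mem_cons, not_or] at h
  obtain ⟨⟨-, h1⟩, h2, h3⟩ := h
  refine ⟨hq.nodup_iff.2 h3, fun o ho => ?_, fun o ho => ?_⟩
  · rw [hq.mem_iff] at ho
    constructor <;> rintro rfl <;> contradiction
  · have := List.disjoint_of_nodup_append h3 ho
    simpa using this

theorem IsWord.handle [DecidableEq α] {X : Finset α} {d f : α × Bool}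
    {A B C D E : List (Option (α × Bool))}
    (hL : IsWord X (A ++ some d :: (B ++ some f :: (C ++ some (bar d) ::
      (D ++ some (bar f) :: E))))) :
    IsWord ((X.erase d.1).erase f.1) (A ++ D ++ C ++ B ++ E) := by
  obtain ⟨hnd, hne⟩ := nodup_handle hL.nodup
  refine ⟨hnd, ?_, fun l => ⟨fun h => ?_, fun h => ?_⟩⟩
  · have := hL.none_mem
    simp only [List.mem_append, List.mem_cons, reduceCtorEq, false_or] at this ⊢
    tauto
  · obtain ⟨h1, h2, h3, h4⟩ := hne _ h
    have h0 : l.1 ∈ X := (hL.some_mem l).1 (by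
      simp only [List.mem_append, List.mem_cons] at h ⊢
      tauto)
    rw [Finset.mem_erase, Finset.mem_erase]
    refine ⟨fun hh => ?_, fun hh => ?_, h0⟩ <;> rcases eq_or_eq_bar hh with hh | hh <;> simp_all
  · simp only [Finset.mem_erase] at h
    have h1 := (hL.some_mem l).2 h.2.2
    have h2 : l ≠ d := fun hh => h.2.1 (by rw [hh])
    have h3 : l ≠ f := fun hh => h.1 (by rw [hh])
    have h4 : l ≠ bar d := fun hh => h.2.1 (by rw [hh]; rfl)
    have h5 : l ≠ bar f := fun hh => h.1 (by rw [hh]; rfl)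
    simp only [List.mem_append, List.mem_cons, Option.some.injEq, h2, h3, h4, h5, false_or] at h1 ⊢
    tauto

theorem IsWord.collapse [DecidableEq α] {X : Finset α} {m : α × Bool}
    {A B C : List (Option (α × Bool))}
    (hL : IsWord X (A ++ some m :: (B ++ some (bar m) :: C))) :
    IsWord (X.erase m.1) (A ++ B ++ C) := by
  obtain ⟨hnd, hne, -⟩ := nodup_collapse hL.nodup
  refine ⟨hnd, ?_, fun l => ⟨fun h => ?_, fun h => ?_⟩⟩
  · have := hL.none_mem
    simp only [List.mem_append, List.mem_cons, reduceCtorEq, false_or] at this ⊢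
    tauto
  · obtain ⟨h1, h2⟩ := hne _ h
    have h0 : l.1 ∈ X := (hL.some_mem l).1 (by
      simp only [List.mem_append, List.mem_cons] at h ⊢
      tauto)
    rw [Finset.mem_erase]
    refine ⟨fun hh => ?_, h0⟩
    rcases eq_or_eq_bar hh with hh | hh <;> simp_all
  · simp only [Finset.mem_erase] at h
    have h1 := (hL.some_mem l).2 h.2
    have h2 : l ≠ m := fun hh => h.1 (by rw [hh])
    have h4 : l ≠ bar m := fun hh => h.1 (by rw [hh]; rfl)
    simp only [List.mem_append, List.mem_cons, Option.some.injEq, h2, h4, false_or] at h1 ⊢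
    tauto

/-- Induction on the number of letters. If the pair m, m̄ is linked with another pair, a commutator
is split off. Otherwise the segment between m and m̄ is closed under inversion, and conjugating its
letters by m removes m and m̄ from the word. A constant K inside the segment then turns into m K
m⁻¹, which is why K varies in the induction. -/
theorem exists_aut_hasNF [DecidableEq α] (n : ℕ) : ∀ (X : Finset α), X.card = n →
    ∀ (L : List (Option (α × Bool))) (K : FreeGroup α), IsWord X L → K ∈ off (X : Set α) →
      ∃ θ : MulAut (FreeGroup α), FixesOff (X : Set α) θ ∧ HasNF X K (θ (val K L)) := by
  induction n using Nat.strong_induction_on with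
  | _ n ih =>
  intro X hX L K hL hK
  by_cases hX0 : X = ∅
  · subst hX0
    refine ⟨1, fun _ _ => rfl, none, [], by simp [pairNames], by simp [pairNames], ?_⟩
    have : L = [none] := by
      have h1 : ∀ o ∈ L, o = none := by
        intro o ho
        cases o with
        | none => rfl
        | some l => simpa using (hL.some_mem l).1 ho
      have h2 := List.eq_replicate_of_mem h1
      have h3 : L.length ≤ 1 := by
        have := hL.nodup
        rw [h2, List.nodup_replicate] at this
        exact this
      have h4 : 0 < L.length := List.length_pos_of_mem hL.none_mem
      have h5 : L.length = 1 := by omega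
      rw [h5] at h2
      exact h2
    subst this
    simp [commProd, ev]
  obtain ⟨x, hx⟩ := Finset.nonempty_iff_ne_empty.2 hX0
  obtain ⟨m, hm, A, B, C, rfl⟩ := exists_split_of_mem_bar (L := L) (l := (x, true))
    ((hL.some_mem _).2 hx) ((hL.some_mem _).2 hx)
  have hmX : m.1 ∈ X := by rw [hm]; exact hx
  by_cases hcross : ∃ e, some e ∈ B ∧ some (bar e) ∉ B
  · obtain ⟨e, heB, heB'⟩ := hcross
    have hLn := hL.nodup
    have heL : some (bar e) ∈ A ++ some m :: (B ++ some (bar m) :: C) :=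
      (hL.some_mem _).2 ((hL.some_mem e).1 (by simp [heB]))
    have hem : e.1 ≠ m.1 := by
      intro h
      rcases eq_or_eq_bar h with h | h <;> subst h <;> grind
    -- The linked pair in its order of appearance: (ē, m) if ē stands before m, and (m, e) if ē
    -- stands after m̄.
    obtain ⟨d, f, hdf, A', B', C', D', E', hsplit⟩ : ∃ d f : α × Bool, d.1 ≠ f.1 ∧
        ∃ A' B' C' D' E', A ++ some m :: (B ++ some (bar m) :: C) =
        A' ++ some d :: (B' ++ some f :: (C' ++ some (bar d) :: (D' ++ some (bar f) :: E'))) := by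
      obtain ⟨B1, B2, rfl⟩ := List.append_of_mem heB
      have : some (bar e) ∈ A ∨ some (bar e) ∈ C := by
        have h1 : bar e ≠ m := fun h => hem (by rw [← h]; rfl)
        have h2 : bar e ≠ bar m := fun h => hem (by rw [← bar_fst e, h]; rfl)
        simp only [List.mem_append, List.mem_cons, Option.some.injEq] at heL heB'
        tauto
      rcases this with h | h
      · obtain ⟨A1, A2, rfl⟩ := List.append_of_mem h
        exact ⟨bar e, m, hem, A1, A2, B1, B2, C, by simp⟩
      · obtain ⟨C1, C2, rfl⟩ := List.append_of_mem h
        exact ⟨m, e, hem.symm, A, B1, B2, C1, C2, by simp⟩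
    rw [hsplit] at hL ⊢
    clear hsplit heL heB' heB hem hLn hm hmX
    have hdX : d.1 ∈ X := (hL.some_mem _).1 (by simp)
    have hfX : f.1 ∈ X := (hL.some_mem _).1 (by simp)
    have hL' := hL.handle
    have hsub' : ∀ l, some l ∈ A' ++ D' ++ C' ++ B' ++ E' → l.1 ∈ X ∧ l.1 ≠ d.1 ∧ l.1 ≠ f.1 := by
      intro l hl
      have := (hL'.some_mem l).1 hl
      simp only [Finset.mem_erase] at this
      tauto
    have hKdf : K ∈ off ({d.1, f.1} : Set α) := off_anti (by
      rintro y (rfl | rfl) <;> assumption) hK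
    have hmem : ∀ M, (∀ o ∈ M, o ∈ A' ++ D' ++ C' ++ B' ++ E') →
        val K M ∈ off ({d.1, f.1} : Set α) := fun M hM => val_mem_off hKdf fun l hl => by
      have := hsub' l (hM _ hl)
      simp [this]
    obtain ⟨θ, hθ, hθv⟩ := exists_aut_handle hdf
      (hmem A' (by simp +contextual)) (hmem B' (by simp +contextual)) (hmem C' (by simp +contextual))
      (hmem D' (by simp +contextual)) (hmem E' (by simp +contextual))
    have hX'sub : ((X.erase d.1).erase f.1 : Finset α) ⊆ X :=
      (Finset.erase_subset _ _).trans (Finset.erase_subset _ _)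
    obtain ⟨θ', hθ', w, P, hnd, hsubP, heq⟩ := ih ((X.erase d.1).erase f.1).card (by
        rw [← hX]
        refine Finset.card_lt_card ((Finset.ssubset_iff_of_subset hX'sub).2 ⟨d.1, hdX, ?_⟩)
        simp) _ rfl _ K hL' (off_anti (by exact_mod_cast hX'sub) hK)
    refine ⟨θ' * θ, (hθ'.mono (by exact_mod_cast hX'sub)).mul (hθ.mono ?_), w,
      P ++ [(bar d, bar f)], ?_, ?_, ?_⟩
    · rintro y (rfl | rfl) <;> assumption
    · have h1 : d.1 ∉ (w.map Prod.fst).toList ++ pairNames P := fun h => by simpa using hsubP _ h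
      have h2 : f.1 ∉ (w.map Prod.fst).toList ++ pairNames P := fun h => by simpa using hsubP _ h
      have : pairNames (P ++ [(bar d, bar f)]) = pairNames P ++ [d.1, f.1] := by simp [pairNames]
      rw [this, ← List.append_assoc]
      refine hnd.append (by simpa using hdf) ?_
      simp only [List.disjoint_cons_right, List.disjoint_nil_right, and_true]
      exact ⟨h1, h2⟩
    · intro y hy
      have : pairNames (P ++ [(bar d, bar f)]) = pairNames P ++ [d.1, f.1] := by simp [pairNames]
      rw [this, ← List.append_assoc, List.mem_append] at hy
      rcases hy with hy | hy
      · exact hX'sub (hsubP y hy)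
      · simp only [List.mem_cons, List.not_mem_nil, or_false] at hy
        rcases hy with rfl | rfl <;> assumption
    · have h1 : val K (A' ++ some d :: (B' ++ some f :: (C' ++ some (bar d) ::
          (D' ++ some (bar f) :: E')))) = val K A' * lt d * val K B' * lt f * val K C' *
          lt (bar d) * val K D' * lt (bar f) * val K E' := by
        simp [mul_assoc]
      have h2 : val K A' * val K D' * val K C' * val K B' * val K E' =
          val K (A' ++ D' ++ C' ++ B' ++ E') := by simp [mul_assoc]
      have h3 : ∀ l : α × Bool, l.1 = d.1 ∨ l.1 = f.1 → θ' (lt l) = lt l := fun l hl =>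
        hθ'.apply_lt (by rcases hl with h | h <;> simp [h])
      rw [MulAut.mul_apply, h1, hθv, h2, map_mul, heq]
      have h4 : θ' (commBar (lt (bar d)) (lt (bar f))) = commBar (lt (bar d)) (lt (bar f)) := by
        simp only [commBar, map_mul, map_inv, h3 (bar d) (Or.inl rfl), h3 (bar f) (Or.inr rfl)]
      rw [h4]
      simp [commProd, mul_assoc]
  · push Not at hcross
    have hL' := hL.collapse
    have hmem : ∀ l, some l ∈ A ++ B ++ C → l.1 ∈ X ∧ l.1 ≠ m.1 := by
      intro l hl
      have := (hL'.some_mem l).1 hl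
      simp only [Finset.mem_erase] at this
      tauto
    have hBAC := (nodup_collapse hL.nodup).2.2
    set K' : FreeGroup α := if none ∈ B then lt m * K * (lt m)⁻¹ else K with hK'
    set Y : Set α := {y | some (y, true) ∈ B} with hY
    have hYmem : ∀ l : α × Bool, some l ∈ B → l.1 ∈ Y := by
      rintro ⟨y, b⟩ hl
      cases b
      · exact hcross _ hl
      · exact hl
    have hYX : Y ⊆ X := fun y hy => (hmem (y, true) (by simp [show some (y, true) ∈ B from hy])).1
    have hYB : ∀ l : α × Bool, l.1 ∈ Y → some l ∈ B := by
      rintro ⟨y, b⟩ hl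
      cases b
      · exact hcross _ (show some (y, true) ∈ B from hl)
      · exact hl
    obtain ⟨θ, hθ, hθc⟩ := exists_aut_conj Y (c := lt m) (lt_mem_off fun h =>
      (hmem m (by simp [hYB m h])).2 rfl)
    have hθK : θ K = K := hθ.apply_of_mem (off_anti hYX hK)
    have hBval : ∀ M, (∀ o ∈ M, o ∈ B) → θ (val K M) = (lt m)⁻¹ * val K' M * lt m := by
      intro M hM
      induction M with
      | nil => simp
      | cons o M ihM =>
        rw [val_cons, map_mul, ihM fun o ho => hM o (by simp [ho])]
        have ho := hM o (by simp)
        have : θ (ev K o) = (lt m)⁻¹ * ev K' o * lt m := by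
          cases o with
          | none =>
            simp only [ev_none, hθK, hK', if_pos ho]
            group
          | some l =>
            rw [ev_some, ev_some]
            exact hθc l (hYmem l ho)
        rw [this, val_cons]
        group
    have hACval : ∀ M, (∀ o ∈ M, o ∉ B) → θ (val K M) = val K' M := by
      intro M hM
      induction M with
      | nil => simp
      | cons o M ihM =>
        rw [val_cons, map_mul, ihM fun o ho => hM o (by simp [ho])]
        have ho := hM o (by simp)
        have : θ (ev K o) = ev K' o := by
          cases o with
          | none => simp only [ev_none, hθK, hK', if_neg ho]
          | some l =>
            rw [ev_some, ev_some]
            exact hθ.apply_lt fun h => ho (hYB l h)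
        rw [this, val_cons]
    have hsubX : ((X.erase m.1 : Finset α) : Set α) ⊆ X := by
      exact_mod_cast Finset.erase_subset _ _
    have hKe : K ∈ off ((X.erase m.1 : Finset α) : Set α) := off_anti hsubX hK
    have hme : lt m ∈ off ((X.erase m.1 : Finset α) : Set α) := lt_mem_off (by simp)
    obtain ⟨θ', hθ', w, P, hnd, hsubP, heq⟩ := ih (X.erase m.1).card (by
        rw [← hX]
        exact Finset.card_erase_lt_of_mem hmX) _ rfl _ K' hL' (by
          rw [hK']
          split_ifs
          · exact mul_mem (mul_mem hme hKe) (inv_mem hme)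
          · exact hKe)
    have hval : θ (val K (A ++ some m :: (B ++ some (bar m) :: C))) = val K' (A ++ B ++ C) := by
      have hmY : m.1 ∉ Y := fun h => (hmem m (by simp [hYB m h])).2 rfl
      simp only [val_append, val_cons, map_mul, ev_some]
      rw [hBval B fun _ h => h, hACval A fun o ho h => (hBAC o h).1 ho,
        hACval C fun o ho h => (hBAC o h).2 ho, hθ.apply_lt hmY,
        hθ.apply_lt (l := bar m) hmY, lt_bar]
      group
    have hfix : FixesOff (X : Set α) (θ' * θ) := (hθ'.mono hsubX).mul (hθ.mono hYX)
    by_cases hB : none ∈ B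
    · rw [if_pos hB] at hK'
      cases w with
      | none =>
        refine ⟨θ' * θ, hfix, some m, P, ?_, ?_, ?_⟩
        · have : m.1 ∉ pairNames P := fun h => by simpa using hsubP m.1 (by simp [h])
          simp only [Option.map_some, Option.toList_some, List.cons_append, List.nil_append,
            List.nodup_cons]
          exact ⟨this, by simpa using hnd⟩
        · intro y hy
          simp only [Option.map_some, Option.toList_some, List.cons_append, List.nil_append,
            List.mem_cons] at hy
          rcases hy with rfl | hy
          · exact hmX
          · exact Finset.mem_of_mem_erase (hsubP y (by simpa using hy))
        · rw [MulAut.mul_apply, hval, heq, hK']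
          simp [ev]
      | some e =>
        have heX : e.1 ∈ X.erase m.1 := hsubP _ (by simp)
        have hem : m.1 ≠ e.1 := fun h => (Finset.mem_erase.1 heX).1 h.symm
        have heP : e.1 ∉ pairNames P := by
          simp only [Option.map_some, Option.toList_some, List.cons_append, List.nil_append,
            List.nodup_cons] at hnd
          exact hnd.1
        -- The constant is now conjugated by the two letters e m; the substitution e ↦ e m⁻¹ leaves
        -- only e.
        obtain ⟨τ, hτ, hτe⟩ := exists_aut_letter e (one_mem _)
          (v := (lt m)⁻¹) (inv_mem (lt_mem_off (by simpa using hem)))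
        have heX' : ({e.1} : Set α) ⊆ X := by simpa using (Finset.mem_erase.1 heX).2
        refine ⟨τ * (θ' * θ), (hτ.mono heX').mul hfix, some e, P, hnd,
          fun y hy => Finset.mem_of_mem_erase (hsubP y hy), ?_⟩
        rw [MulAut.mul_apply, MulAut.mul_apply, hval, heq, hK']
        simp only [ev_some, map_mul, map_inv, hτe, hτ.apply_of_mem (off_anti heX' hK),
          hτ.apply_lt (l := m) (by simpa using hem),
          hτ.apply_of_mem (commProd_mem_off (X := {e.1}) (P := P)
            fun y hy h => heP (by rw [← Set.mem_singleton_iff.1 h]; exact hy))]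
        group
    · rw [if_neg hB] at hK'
      refine ⟨θ' * θ, hfix, w, P, hnd, fun y hy => Finset.mem_of_mem_erase (hsubP y hy), ?_⟩
      rw [MulAut.mul_apply, hval, heq, hK']

end NormalForm

/-! ### Nielsen reduction with a rank to break ties -/

section Nielsen

open FreeGroup

variable {α : Type*} [DecidableEq α]

theorem toWord_eq_of_isReduced {u : FreeGroup α} {L : List (α × Bool)} (hL : IsReduced L)
    (h : u = mk L) : u.toWord = L := by
  rw [h, toWord_mk, hL.reduce_eq]

/-- The cancellation in a product. -/
theorem exists_cancel (u v : FreeGroup α) : ∃ A K B, u.toWord = A ++ K ∧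
    v.toWord = invRev K ++ B ∧ (u * v).toWord = A ++ B := by
  suffices ∀ U V : List (α × Bool), IsReduced U → IsReduced V → ∃ A K B, U = A ++ K ∧
      V = invRev K ++ B ∧ IsReduced (A ++ B) by
    obtain ⟨A, K, B, h1, h2, h3⟩ := this u.toWord v.toWord isReduced_toWord isReduced_toWord
    refine ⟨A, K, B, h1, h2, toWord_eq_of_isReduced h3 ?_⟩
    rw [← mk_toWord (x := u), ← mk_toWord (x := v), h1, h2, ← mul_mk, ← mul_mk, ← mul_mk,
      ← inv_mk]
    group
  intro U
  induction U using List.reverseRecOn with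
  | nil => exact fun V _ hV => ⟨[], [], V, rfl, rfl, hV⟩
  | append_singleton U a ih =>
    intro V hU hV
    cases V with
    | nil => exact ⟨U ++ [a], [], [], by simp, rfl, by simpa using hU⟩
    | cons b V =>
      by_cases hab : b = bar a
      · subst hab
        obtain ⟨A, K, B, h1, h2, h3⟩ := ih V (hU.infix ⟨[], [a], by simp⟩)
          (hV.infix ⟨[bar a], [], by simp⟩)
        exact ⟨A, K ++ [a], B, by simp [h1], by simp [h2, invRev, bar], h3⟩
      · refine ⟨U ++ [a], [], b :: V, by simp, rfl, ?_⟩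
        refine List.IsChain.append hU hV ?_
        intro x hx y hy
        simp only [List.getLast?_append, List.getLast?_singleton, Option.some_or, Option.mem_def,
          Option.some.injEq, List.head?_cons] at hx hy
        subst hx hy
        intro h
        rcases eq_or_eq_bar h with h | h
        · rw [h]
        · exact absurd (by rw [h, bar_bar]) hab

/-- A ranking of words that is monotone under changing a suffix. -/
structure WordRank (α : Type*) where
  /-- The rank of a word. -/
  rank : List (α × Bool) → ℕ
  append_lt : ∀ t p q, p.length = q.length → rank q < rank p → rank (t ++ q) < rank (t ++ p)
  inj : ∀ p q, p.length = q.length → rank p = rank q → p = q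

/-- Words are read as numerals with the last letter most significant, so a common prefix does not
affect comparisons. The summand 2 makes the base exceed 1 in every case. -/
theorem exists_wordRank {V : List (α × Bool)} (hV : ∀ l, l ∈ V) : Nonempty (WordRank α) := by
  have hlt : ∀ l, V.idxOf l < V.length + 2 := fun l => by
    have := List.idxOf_lt_length_of_mem (hV l)
    omega
  refine ⟨⟨fun L => Nat.ofDigits (V.length + 2) (L.map V.idxOf), ?_, ?_⟩⟩
  · intro t p q _ h
    simp only [List.map_append, Nat.ofDigits_append]
    gcongr
  · intro p q hpq h
    have := Nat.ofDigits_inj_of_len_eq (b := V.length + 2) (by omega) (by simpa using hpq)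
      (by simp only [List.mem_map]; rintro _ ⟨l, -, rfl⟩; exact hlt l)
      (by simp only [List.mem_map]; rintro _ ⟨l, -, rfl⟩; exact hlt l) h
    refine List.map_injective_iff.2 ?_ this
    intro a b hab
    exact (List.idxOf_inj (hV a)).1 hab

variable (N : WordRank α)

/-- The second half of the reduced word of `u` (rounded down). -/
def tail (u : FreeGroup α) : List (α × Bool) :=
  u.toWord.drop (u.toWord.length - u.toWord.length / 2)

/-- Replacing `v` by `u * v` decreases the length, or keeps it and decreases the rank of the halves. -/
def Gain (u v : FreeGroup α) : Prop :=
  ∃ A K B, u.toWord = A ++ K ∧ v.toWord = invRev K ++ B ∧ (u * v).toWord = A ++ B ∧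
    (A.length < K.length ∨ A.length = K.length ∧ K.length ≤ B.length ∧
      N.rank (invRev A) < N.rank K)

/-- At most half of `u` and of `v` cancels in `u * v`, and a half only if it has smaller rank than
the other half. -/
def Tight (u v : FreeGroup α) : Prop :=
  ∃ A K B, u.toWord = A ++ K ∧ v.toWord = invRev K ++ B ∧ (u * v).toWord = A ++ B ∧
    K.length ≤ A.length ∧ K.length ≤ B.length ∧
    (K.length = A.length → N.rank K < N.rank (invRev A)) ∧
    (K.length = B.length → N.rank K < N.rank B)

/-- Without a gain on either side, the cancelled part K is at most half of each factor, with rank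
inequalities in case of equality. These are strict: equal ranks would give K = A⁻¹ or K = B, hence u
= 1 or v = 1. -/
theorem tight_or_gain {u v : FreeGroup α} (hu : u ≠ 1) (hv : v ≠ 1) :
    Tight N u v ∨ Gain N u v ∨ Gain N v⁻¹ u⁻¹ := by
  obtain ⟨A, K, B, h1, h2, h3⟩ := exists_cancel u v
  by_cases hg : Gain N u v
  · exact Or.inr (Or.inl hg)
  by_cases hg' : Gain N v⁻¹ u⁻¹
  · exact Or.inr (Or.inr hg')
  have e1 : ¬(A.length < K.length ∨ A.length = K.length ∧ K.length ≤ B.length ∧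
      N.rank (invRev A) < N.rank K) := fun h => hg ⟨A, K, B, h1, h2, h3, h⟩
  have e2 : ¬((invRev B).length < K.length ∨ (invRev B).length = K.length ∧
      K.length ≤ (invRev A).length ∧ N.rank (invRev (invRev B)) < N.rank K) := fun h =>
    hg' ⟨invRev B, K, invRev A, by simp [toWord_inv, h2], by simp [toWord_inv, h1], by
      rw [← mul_inv_rev, toWord_inv, h3, invRev_append], h⟩
  simp only [invRev_length, invRev_invRev, not_or, not_lt, not_and] at e1 e2
  refine Or.inl ⟨A, K, B, h1, h2, h3, e1.1, e2.1, fun h => ?_, fun h => ?_⟩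
  · refine lt_of_le_of_ne (e1.2 h.symm e2.1) fun hne => hu ?_
    have := N.inj K (invRev A) (by simpa using h) hne
    rw [← mk_toWord (x := u), h1, this, ← mul_mk, ← inv_mk, mul_inv_cancel]
  · refine lt_of_le_of_ne (e2.2 h.symm e1.1) fun hne => hv ?_
    have := N.inj K B h hne
    rw [← mk_toWord (x := v), h2, this, ← mul_mk, ← inv_mk, inv_mul_cancel]

theorem sum_map_change {V : List (α × Bool)} (hV : V.Nodup) (hm : ∀ l, l ∈ V) (d : α × Bool)
    {f f' : α × Bool → ℕ} (hf : ∀ l, l.1 ≠ d.1 → f' l = f l) :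
    (V.map f').sum + (f d + f (bar d)) = (V.map f).sum + (f' d + f' (bar d)) := by
  have hp : V.Perm (d :: bar d :: (V.erase d).erase (bar d)) :=
    (List.perm_cons_erase (hm d)).trans ((List.perm_cons_erase
      ((List.mem_erase_of_ne (bar_ne d)).2 (hm _))).cons d)
  have hR : ∀ l ∈ (V.erase d).erase (bar d), f' l = f l := by
    intro l hl
    rw [(hV.erase d).mem_erase_iff, hV.mem_erase_iff] at hl
    refine hf l fun h => ?_
    rcases eq_or_eq_bar h with h | h
    · exact hl.2.1 h
    · exact hl.1 h
  rw [(hp.map f).sum_eq, (hp.map f').sum_eq]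
  simp only [List.map_cons, List.sum_cons, List.map_congr_left hR]
  omega

/-- The total length of the values of the letters. -/
def totalLength (V : List (α × Bool)) (φ : MulAut (FreeGroup α)) : ℕ :=
  (V.map fun l => (φ (lt l)).toWord.length).sum

/-- The total rank of the halves of the values of the letters. -/
def totalRank (V : List (α × Bool)) (φ : MulAut (FreeGroup α)) : ℕ :=
  (V.map fun l => N.rank (tail (φ (lt l)))).sum

/-- Only the values of d and d̄ change. In the tie case |K| ≤ |B|, so the tail of the value of d
lies inside B and stays, while the tail of the value of d̄ ends in A⁻¹ instead of K, which has
smaller rank. -/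
theorem decrease_of_gain {V : List (α × Bool)} (hV : V.Nodup) (hm : ∀ l, l ∈ V)
    {φ φ' : MulAut (FreeGroup α)} {c d : α × Bool} (hg : Gain N (φ (lt c)) (φ (lt d)))
    (h1 : ∀ l, l.1 ≠ d.1 → φ' (lt l) = φ (lt l)) (h2 : φ' (lt d) = φ (lt c) * φ (lt d)) :
    totalLength V φ' < totalLength V φ ∨
      totalLength V φ' = totalLength V φ ∧ totalRank N V φ' < totalRank N V φ := by
  obtain ⟨A, K, B, hc, hd, hcd, hg⟩ := hg
  rw [← h2] at hcd
  have hdb : (φ (lt (bar d))).toWord = invRev B ++ K := by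
    rw [lt_bar, _root_.map_inv, toWord_inv, hd, invRev_append, invRev_invRev]
  have hdb' : (φ' (lt (bar d))).toWord = invRev B ++ invRev A := by
    rw [lt_bar, _root_.map_inv, toWord_inv, hcd, invRev_append]
  have key1 := sum_map_change hV hm d (f := fun l => (φ (lt l)).toWord.length)
    (f' := fun l => (φ' (lt l)).toWord.length) fun l hl => by rw [h1 l hl]
  have key2 := sum_map_change hV hm d (f := fun l => N.rank (tail (φ (lt l))))
    (f' := fun l => N.rank (tail (φ' (lt l)))) fun l hl => by rw [h1 l hl]
  simp only [hd, hdb, hcd, hdb', List.length_append, invRev_length] at key1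
  change totalLength V φ' + _ = totalLength V φ + _ at key1
  change totalRank N V φ' + _ = totalRank N V φ + _ at key2
  rcases hg with hg | ⟨hg1, hg2, hg3⟩
  · left
    omega
  · right
    refine ⟨by omega, ?_⟩
    have hdrop : ∀ X : List (α × Bool), X.length = K.length →
        (X ++ B).drop ((X ++ B).length - (X ++ B).length / 2) =
          B.drop (K.length + B.length - (K.length + B.length) / 2 - K.length) := by
      intro X hX
      rw [List.drop_append, List.drop_eq_nil_of_le, List.nil_append, List.length_append, hX]
      rw [List.length_append]
      omega
    have e1 : tail (φ' (lt d)) = tail (φ (lt d)) := by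
      rw [tail, tail, hd, hcd, hdrop A hg1, hdrop _ invRev_length]
    have e2 : N.rank (tail (φ' (lt (bar d)))) < N.rank (tail (φ (lt (bar d)))) := by
      rw [tail, tail, hdb, hdb', List.drop_append_of_le_length, List.drop_append_of_le_length]
      · simp only [List.length_append, invRev_length, hg1]
        exact N.append_lt _ _ _ (by simp [hg1]) hg3
      · simp only [List.length_append, invRev_length]
        omega
      · simp only [List.length_append, invRev_length]
        omega
    rw [e1] at key2
    omega

/-- The word `w` is cut into a left part of length `k`, a middle part `M` and a right part of length
`k'`, where the left and right parts are at most halves, and of smaller rank if they are halves. -/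
def Cell (w : List (α × Bool)) (k : ℕ) (M : List (α × Bool)) (k' : ℕ) : Prop :=
  ∃ P Q, w = P ++ (M ++ Q) ∧ P.length = k ∧ Q.length = k' ∧ M ≠ [] ∧ 2 * k ≤ w.length ∧
    2 * k' ≤ w.length ∧ (2 * k = w.length → N.rank (invRev P) < N.rank (M ++ Q)) ∧
    (2 * k' = w.length → N.rank Q < N.rank (invRev (P ++ M)))

/-- The words `w v` are cut into cells that match along `V`. -/
inductive Cut (w : α × Bool → FreeGroup α) : ℕ → List (α × Bool) → List (List (α × Bool)) → Prop
  | nil : Cut w 0 [] []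
  | cons (k k' : ℕ) (v : α × Bool) (M : List (α × Bool)) (V : List (α × Bool))
      (Ms : List (List (α × Bool))) (h : Cell N (w v).toWord k M k') (h' : Cut w k' V Ms) :
      Cut w k (v :: V) (M :: Ms)

/-- The prefix A of the first value is kept apart from the cells because a letter put in front of v
may still cancel a part of it. -/
theorem exists_cut_aux {w : α × Bool → FreeGroup α} (hw : ∀ l, w l ≠ 1) (V : List (α × Bool)) :
    ∀ v, List.IsChain (fun a b => Tight N (w a) (w b)) (v :: V) →
      ∃ A Q Ms, (w v).toWord = A ++ Q ∧ ((v :: V).map w).prod.toWord = A ++ Ms.flatten ∧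
        Q.length ≤ A.length ∧ (Q.length = A.length → N.rank Q < N.rank (invRev A)) ∧
        Cut N w Q.length V Ms := by
  induction V with
  | nil =>
    intro v _
    refine ⟨(w v).toWord, [], [], by simp, by simp, by simp, ?_, Cut.nil⟩
    intro h
    exact absurd (toWord_eq_nil_iff.1 (List.length_eq_zero_iff.1 h.symm)) (hw v)
  | cons u V ih =>
    intro v hch
    rw [List.isChain_cons_cons] at hch
    obtain ⟨⟨A, K, B, h1, h2, h3, h4, h5, h6, h7⟩, hch⟩ := hch
    obtain ⟨A', Q, Ms, e1, e2, e3, e4, e5⟩ := ih u hch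
    have hpre : ∃ M, A' = invRev K ++ M ∧ B = M ++ Q := by
      rw [h2] at e1
      rcases List.append_eq_append_iff.1 e1 with ⟨M, ha, hb⟩ | ⟨M, ha, hb⟩
      · exact ⟨M, ha, hb⟩
      · have l1 := congrArg List.length ha
        have l2 := congrArg List.length hb
        simp only [List.length_append, invRev_length] at l1 l2
        have : M = [] := List.length_eq_zero_iff.1 (by omega)
        subst this
        exact ⟨[], by simpa using ha.symm, by simpa using hb.symm⟩
    obtain ⟨M, rfl, rfl⟩ := hpre
    simp only [List.length_append, invRev_length] at e3 e4 h5 h7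
    -- If nothing survived, the value of u would be K⁻¹Q with both parts of equal length, and each
    -- of K and Q would have smaller rank than the other.
    have hM : M ≠ [] := by
      rintro rfl
      have hl : Q.length = K.length := by simp at e3 h5; omega
      have a1 := e4 (by simpa using hl)
      have a2 := h7 (by simpa using hl.symm)
      simp only [List.append_nil, invRev_invRev, List.nil_append] at a1 a2
      omega
    refine ⟨A, K, M :: Ms, h1, ?_, h4, h6, ?_⟩
    · rw [List.map_cons, List.prod_cons, List.flatten_cons, ← List.append_assoc]
      refine toWord_eq_of_isReduced ?_ ?_
      · refine IsReduced.append_overlap ?_ ?_ hM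
        · have : IsReduced (A ++ (M ++ Q)) := h3 ▸ isReduced_toWord
          exact this.infix ⟨[], Q, by simp⟩
        · have : IsReduced (invRev K ++ M ++ Ms.flatten) := e2 ▸ isReduced_toWord
          exact this.infix ⟨invRev K, [], by simp⟩
      · rw [← mk_toWord (x := w v), ← mk_toWord (x := (List.map w (u :: V)).prod), h1, e2]
        simp only [← mul_mk, ← inv_mk]
        group
    · refine Cut.cons _ _ _ _ _ _ ⟨invRev K, Q, by rw [h2], by simp, rfl, hM, ?_, ?_, ?_, ?_⟩ e5
      · simp only [h2, List.length_append, invRev_length]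
        omega
      · simp only [h2, List.length_append, invRev_length]
        omega
      · simp only [h2, List.length_append, invRev_length, invRev_invRev]
        intro h
        exact h7 (by omega)
      · simp only [h2, List.length_append, invRev_length]
        intro h
        exact e4 (by omega)

theorem exists_cut {w : α × Bool → FreeGroup α} (hw : ∀ l, w l ≠ 1) {V : List (α × Bool)}
    (h : List.IsChain (fun a b => Tight N (w a) (w b)) V) :
    ∃ Ms, (V.map w).prod.toWord = Ms.flatten ∧ Cut N w 0 V Ms := by
  cases V with
  | nil => exact ⟨[], by simp, Cut.nil⟩
  | cons v V =>
    obtain ⟨A, Q, Ms, h1, h2, h3, h4, h5⟩ := exists_cut_aux N hw V v h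
    have hpos : 0 < (w v).toWord.length :=
      List.length_pos_iff.2 fun h => hw v (toWord_eq_nil_iff.1 h)
    have hlen : (w v).toWord.length = A.length + Q.length := by simp [h1]
    refine ⟨A :: Ms, by simpa using h2, Cut.cons _ _ _ _ _ _ ⟨[], Q, by simpa using h1, rfl, rfl, ?_,
      by simp, by omega, by omega, fun h => ?_⟩ h5⟩
    · rintro rfl
      rw [List.length_nil] at h3 hlen
      omega
    · simpa using h4 (by omega)

variable {N}

theorem Cut.ne_nil {w : α × Bool → FreeGroup α} {k : ℕ} {V : List (α × Bool)}
    {Ms : List (List (α × Bool))} (h : Cut N w k V Ms) :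
    V.length = Ms.length ∧ ∀ M ∈ Ms, M ≠ [] := by
  induction h with
  | nil => simp
  | cons k k' v M V Ms h h' ih =>
    obtain ⟨P, Q, -, -, -, hM, -⟩ := h
    simp [ih.1, hM]
    exact ih.2

theorem Cut.exists_cell {w : α × Bool → FreeGroup α} {k : ℕ} {V : List (α × Bool)}
    {Ms : List (List (α × Bool))} (h : Cut N w k V Ms) :
    (∀ v ∈ V, ∃ M k k', (v, M) ∈ V.zip Ms ∧ Cell N (w v).toWord k M k') := by
  induction h with
  | nil => simp
  | cons k k' v M V Ms h h' ih =>
    intro u hu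
    rcases List.mem_cons.1 hu with rfl | hu
    · exact ⟨M, k, k', by simp, h⟩
    · obtain ⟨M', j, j', h1, h2⟩ := ih u hu
      exact ⟨M', j, j', by simp [h1], h2⟩

theorem length_le_length_flatten {β : Type*} {Ms : List (List β)} (hne : ∀ M ∈ Ms, M ≠ []) :
    Ms.length ≤ Ms.flatten.length := by
  induction Ms with
  | nil => simp
  | cons M Ms ih =>
    have h1 := ih fun M hM => hne M (List.mem_cons_of_mem _ hM)
    have h2 : 0 < M.length := List.length_pos_iff.2 (hne M List.mem_cons_self)
    simp only [List.length_cons, List.flatten_cons, List.length_append]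
    omega

theorem eq_map_singleton_of_flatten {β : Type*} {Ms : List (List β)}
    (hl : Ms.flatten.length ≤ Ms.length) (hne : ∀ M ∈ Ms, M ≠ []) :
    Ms = Ms.flatten.map fun t => [t] := by
  induction Ms with
  | nil => simp
  | cons M Ms ih =>
    have hne' : ∀ M ∈ Ms, M ≠ [] := fun M hM => hne M (List.mem_cons_of_mem _ hM)
    have h1 := length_le_length_flatten hne'
    have h2 : 0 < M.length := List.length_pos_iff.2 (hne M List.mem_cons_self)
    simp only [List.length_cons, List.flatten_cons, List.length_append] at hl
    obtain ⟨a, rfl⟩ := List.length_eq_one_iff.1 (show M.length = 1 by omega)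
    have := ih (by rw [List.length_singleton] at hl; omega) hne'
    simpa using this

-- Here k + k' = |w| − 1 and neither exceeds half of |w|. So k = k' if |w| is odd; if |w| is even,
-- one of them is exactly half, and the rank of the two halves decides which one. The decision for
-- w⁻¹ is the mirror image.
omit [DecidableEq α] in
theorem Cell.pair {w : List (α × Bool)} {k k' j j' : ℕ} {m m' : α × Bool}
    (h : Cell N w k [m] k') (h' : Cell N (invRev w) j [m'] j') :
    j = k' ∧ j' = k ∧ m' = bar m := by
  obtain ⟨P, Q, e1, hP, hQ, -, c1, c2, c3, c4⟩ := h
  obtain ⟨P', Q', e2, hP', hQ', -, d1, d2, d3, d4⟩ := h'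
  have l1 : w.length = k + (1 + k') := by
    rw [e1]
    simp [hP, hQ]
    omega
  have l2 : w.length = j + (1 + j') := by
    rw [← invRev_length, e2]
    simp [hP', hQ']
    omega
  have e3 : invRev w = invRev Q ++ ([bar m] ++ invRev P) := by
    rw [e1]
    simp [invRev, bar]
  rw [invRev_length] at d1 d2 d3 d4
  have hjk : j = k' := by
    by_contra hne
    by_cases hk : 2 * k = w.length
    · have hj : 2 * j = w.length := by omega
      have h1 := c3 hk
      have h2 := d3 hj
      have h3 : invRev w = invRev ([m] ++ Q) ++ invRev P := by rw [e1, invRev_append]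
      rw [e2] at h3
      obtain ⟨h4, h5⟩ := List.append_inj h3 (by simp [hP', hQ]; omega)
      rw [h4, h5, invRev_invRev] at h2
      omega
    · have hk' : 2 * k' = w.length := by omega
      have hj : 2 * j' = w.length := by omega
      have h1 := c4 hk'
      have h2 := d4 hj
      have h3 : invRev w = invRev Q ++ invRev (P ++ [m]) := by
        rw [e1, ← List.append_assoc, invRev_append]
      rw [e2, ← List.append_assoc] at h3
      obtain ⟨h4, h5⟩ := List.append_inj h3 (by simp [hP', hQ]; omega)
      rw [h4, h5, invRev_invRev] at h2
      omega
  refine ⟨hjk, by omega, ?_⟩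
  rw [e2] at e3
  have := (List.append_inj e3 (by simp [hP', hQ, hjk])).2
  exact (List.cons.inj this).1

theorem apply_lt_ne_one (φ : MulAut (FreeGroup α)) (l : α × Bool) :
    φ (lt l) ≠ 1 := by
  intro h
  rw [map_eq_one_iff φ φ.injective] at h
  have := congrArg toWord h
  rw [lt, toWord_mk, reduce_singleton, toWord_one] at this
  simp at this

/-- If no Nielsen move applies, the first letter is sent to the first letter of the word. -/
theorem apply_head_of_isChain_tight {V T : List (α × Bool)} (hV : V.Nodup) (hVm : ∀ l, l ∈ V)
    {a b : α × Bool} (hT : (a :: b :: bar a :: bar b :: T).Nodup)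
    (hTm : ∀ l, l ∈ a :: b :: bar a :: bar b :: T) {φ : MulAut (FreeGroup α)}
    (hφ : φ (mk V) = mk (a :: b :: bar a :: bar b :: T))
    (hch : List.IsChain (fun c d => Tight N (φ (lt c)) (φ (lt d))) V) :
    ∃ v V', V = v :: V' ∧ φ (lt v) = lt a := by
  set T0 := a :: b :: bar a :: bar b :: T with hT0
  obtain ⟨Ms, hMs, hcut⟩ := exists_cut N (w := fun l => φ (lt l)) (apply_lt_ne_one φ) hch
  obtain ⟨hlen, hne⟩ := hcut.ne_nil
  have hprod : (V.map fun l => φ (lt l)).prod = mk T0 := by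
    rw [← hφ, mk_eq_prod V, map_list_prod, List.map_map]
    rfl
  have hperm : V.Perm T0 := (List.perm_ext_iff_of_nodup hV hT).2 fun l => by
    simp only [hVm l, hTm l]
  rw [hprod, toWord_mk] at hMs
  -- There are as many nonempty pieces as letters in `T0`, and reduction does not lengthen a word.
  -- So `T0` is already reduced and each piece is a single letter.
  have hTMs : Ms.flatten = T0 := by
    have hsub : (reduce T0).Sublist T0 := Red.sublist reduce.red
    have hge := length_le_length_flatten hne
    rw [← hMs]
    refine hsub.eq_of_length_le ?_
    rw [hMs, ← hperm.length_eq, hlen]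
    exact hge
  have hsing := eq_map_singleton_of_flatten (by rw [hTMs, ← hlen, hperm.length_eq]) hne
  rw [hTMs] at hsing
  subst hsing
  -- If v contributes m, then v̄ contributes m̄ by `Cell.pair`. Since m̄ occurs only once in `T0`,
  -- the letter u contributing it is v̄, so the cuts of u mirror those of v.
  have hpair : ∀ v k m k', Cell N (φ (lt v)).toWord k [m] k' → (v, [m]) ∈ V.zip (T0.map fun t => [t])
      → ∀ u j m' j', Cell N (φ (lt u)).toWord j [m'] j' →
      (u, [m']) ∈ V.zip (T0.map fun t => [t]) → m' = bar m → j = k' ∧ j' = k := by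
    intro v k m k' hc hz u j m' j' hc' hz' hm
    obtain ⟨M, i, i', h1, h2⟩ := hcut.exists_cell (bar v) (hVm _)
    have hM := (List.of_mem_zip h1).2
    obtain ⟨m'', hm'', rfl⟩ := List.mem_map.1 hM
    simp only [lt_bar, _root_.map_inv, toWord_inv] at h2
    obtain ⟨-, -, h3⟩ := hc.pair h2
    have huv : u = bar v := by
      obtain ⟨p, hp, hp'⟩ := List.mem_iff_getElem.1 hz'
      obtain ⟨q, hq, hq'⟩ := List.mem_iff_getElem.1 h1
      simp only [List.length_zip, List.length_map] at hp hq
      simp only [List.getElem_zip, List.getElem_map, Prod.mk.injEq, List.cons.injEq, and_true] at hp' hq'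
      have : p = q := (hT.getElem_inj_iff).1 (by rw [hp'.2, hq'.2, hm, h3])
      subst this
      rw [← hp'.1, ← hq'.1]
    subst huv
    simp only [lt_bar, _root_.map_inv, toWord_inv] at hc'
    obtain ⟨h4, h5, -⟩ := hc.pair hc'
    exact ⟨h4, h5⟩
  rw [hT0] at hcut
  simp only [List.map_cons] at hcut
  cases hcut with | cons _ k1 v0 _ V0 _ c0 hcut =>
  cases hcut with | cons _ k2 v1 _ V1 _ c1 hcut =>
  cases hcut with | cons _ k3 v2 _ V2 _ c2 hcut =>
  cases hcut with | cons _ k4 v3 _ V3 _ c3 hcut =>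
  -- The pair a, ā gives k2 = k1 and k3 = 0; the pair b, b̄ gives k3 = k2. Hence k1 = 0 and nothing
  -- of the first value cancels.
  obtain ⟨h1, h2⟩ := hpair v0 _ _ _ c0 (by simp [hT0]) v2 _ _ _ c2 (by simp [hT0]) rfl
  obtain ⟨h3, h4⟩ := hpair v1 _ _ _ c1 (by simp [hT0]) v3 _ _ _ c3 (by simp [hT0]) rfl
  refine ⟨v0, _, rfl, ?_⟩
  obtain ⟨P, Q, e, hP, hQ, -⟩ := c0
  have hP0 : P = [] := List.length_eq_zero_iff.1 hP
  have hQ0 : Q = [] := List.length_eq_zero_iff.1 (by omega)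
  subst hP0 hQ0
  rw [← mk_toWord (x := φ (lt v0)), e]
  rfl

end Nielsen

/-! ### The Heisenberg group, whose commutators compute a symplectic form -/

section Heisenberg

/-- The integral Heisenberg group. -/
@[ext]
structure Heis where
  /-- The first coordinate. -/
  a : ℤ
  /-- The second coordinate. -/
  b : ℤ
  /-- The central coordinate. -/
  c : ℤ

namespace Heis

instance : Mul Heis := ⟨fun x y => ⟨x.a + y.a, x.b + y.b, x.c + y.c + x.a * y.b⟩⟩
instance : One Heis := ⟨⟨0, 0, 0⟩⟩
instance : Inv Heis := ⟨fun x => ⟨-x.a, -x.b, -x.c + x.a * x.b⟩⟩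

@[simp] theorem mul_a (x y : Heis) : (x * y).a = x.a + y.a := rfl
@[simp] theorem mul_b (x y : Heis) : (x * y).b = x.b + y.b := rfl
@[simp] theorem mul_c (x y : Heis) : (x * y).c = x.c + y.c + x.a * y.b := rfl
@[simp] theorem one_a : (1 : Heis).a = 0 := rfl
@[simp] theorem one_b : (1 : Heis).b = 0 := rfl
@[simp] theorem one_c : (1 : Heis).c = 0 := rfl
@[simp] theorem inv_a (x : Heis) : (x⁻¹).a = -x.a := rfl
@[simp] theorem inv_b (x : Heis) : (x⁻¹).b = -x.b := rfl
@[simp] theorem inv_c (x : Heis) : (x⁻¹).c = -x.c + x.a * x.b := rfl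

instance : Group Heis := Group.ofLeftAxioms
  (fun x y z => by ext <;> simp <;> ring) (fun x => by ext <;> simp) (fun x => by ext <;> simp)

theorem commBar_eq (x y : Heis) : commBar x y = ⟨0, 0, x.a * y.b - y.a * x.b⟩ := by
  ext <;> simp [commBar]
  ring

/-- The first coordinate as a homomorphism. -/
def homA : Heis →* Multiplicative ℤ where
  toFun x := Multiplicative.ofAdd x.a
  map_one' := rfl
  map_mul' _ _ := rfl

/-- The second coordinate as a homomorphism. -/
def homB : Heis →* Multiplicative ℤ where
  toFun x := Multiplicative.ofAdd x.b
  map_one' := rfl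
  map_mul' _ _ := rfl

end Heis

end Heisenberg

/-! ### The surface word involves every basis element, in any basis -/

section SurfaceWord

variable {g : ℕ}

theorem surfaceWord_zero : surfaceWord g 0 =
    (List.ofFn fun i : Fin g => commBar (xx i : F g 0) (yy i)).prod := by
  simp [surfaceWord]

theorem Gen.cases0 {P : Gen g 0 → Prop} (hx : ∀ i, P (Gen.x i)) (hy : ∀ i, P (Gen.y i)) (m) :
    P m := by
  cases m with
  | t j => exact j.elim0
  | x i => exact hx i
  | y i => exact hy i

theorem prod_ofFn_single {G : Type*} [Monoid G] (n : ℕ) (f : Fin n → G) (i : Fin n)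
    (h : ∀ j, j ≠ i → f j = 1) : (List.ofFn f).prod = f i := by
  induction n with
  | zero => exact i.elim0
  | succ n ih =>
    rw [List.ofFn_succ, List.prod_cons]
    refine Fin.cases (motive := fun i => (∀ j, j ≠ i → f j = 1) → _ = f i) ?_ ?_ i h
    · intro h
      have : (List.ofFn fun i : Fin n => f i.succ).prod = 1 := List.prod_eq_one (by
        simp only [List.mem_ofFn]
        rintro _ ⟨j, rfl⟩
        exact h _ (Fin.succ_ne_zero j))
      rw [this, mul_one]
    · intro i h
      rw [h 0 (Fin.succ_ne_zero i).symm, one_mul]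
      exact ih (fun i => f i.succ) i fun j hj => h _ fun hh => hj (Fin.succ_injective _ hh)

/-- No automorphic image of the surface word lies in a proper free factor generated by basis
elements. -/
theorem apply_surfaceWord_not_mem_off (φ : MulAut (F g 0)) (x : Gen g 0) :
    φ (surfaceWord g 0) ∉ off {x} := by
  intro hmem
  -- The exponent sum of x; composed with φ it is still nontrivial.
  let α : F g 0 →* Multiplicative ℤ :=
    FreeGroup.lift fun l => if l = x then Multiplicative.ofAdd 1 else 1
  obtain ⟨m, hm⟩ : ∃ m, α (φ (FreeGroup.of m)) ≠ 1 := by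
    by_contra! hcon
    have h1 : α.comp φ.toMonoidHom = 1 := by
      ext m
      exact congrArg Multiplicative.toAdd (hcon m)
    have h2 : α (FreeGroup.of x) = 1 := by
      have := DFunLike.congr_fun h1 (φ⁻¹ (FreeGroup.of x))
      simpa using this
    have h3 := congrArg Multiplicative.toAdd h2
    simp [α] at h3
  -- The map `h` kills the surface word because its image has first coordinate 0, where commutators
  -- vanish. Altering h ∘ φ⁻¹ at x alone is invisible on φ(surface word), which omits x, but it
  -- makes the first coordinate equal to α.
  have key : ∀ m' : Gen g 0, ∃ f : F g 0 →* Heis, f (surfaceWord g 0) = 1 ∧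
      ∀ n, (f (FreeGroup.of n)).a = Multiplicative.toAdd (α (φ (FreeGroup.of n))) ∧
        (f (FreeGroup.of n)).b = if n = m' then 1 else 0 := by
    intro m'
    let h : F g 0 →* Heis := FreeGroup.lift fun n => if n = m' then ⟨0, 1, 0⟩ else 1
    let f0 : F g 0 →* Heis := h.comp (φ⁻¹ : MulAut (F g 0)).toMonoidHom
    let f1 : F g 0 →* Heis :=
      FreeGroup.lift fun l => if l = x then ⟨1, 0, 0⟩ * f0 (FreeGroup.of l) else f0 (FreeGroup.of l)
    have hcomm : ∀ u, (h u).a = 0 := by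
      have : Heis.homA.comp h = 1 := by
        ext n
        by_cases hn : n = m' <;> simp [h, hn, Heis.homA]
      intro u
      exact congrArg Multiplicative.toAdd (DFunLike.congr_fun this u)
    have hA : Heis.homA.comp f1 = α := by
      ext l
      by_cases hl : l = x <;> simp [f1, hl, α, Heis.homA, f0, hcomm]
    have hB : Heis.homB.comp f1 = Heis.homB.comp f0 := by
      ext l
      by_cases hl : l = x <;> simp [f1, hl, Heis.homB]
    have hoff : ∀ u ∈ off {x}, f1 u = f0 u := by
      intro u hu
      have : off {x} ≤ f1.eqLocus f0 := by
        rw [off, Subgroup.closure_le]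
        rintro _ ⟨y, hy, rfl⟩
        have hy' : y ≠ x := hy
        change f1 _ = f0 _
        simp [f1, hy']
      exact this hu
    refine ⟨f1.comp φ.toMonoidHom, ?_, fun n => ⟨?_, ?_⟩⟩
    · change f1 (φ (surfaceWord g 0)) = 1
      rw [hoff _ hmem]
      change h (φ⁻¹ (φ (surfaceWord g 0))) = 1
      rw [MulAut.inv_apply_self, surfaceWord_zero, map_list_prod]
      refine List.prod_eq_one fun w hw => ?_
      simp only [List.map_ofFn, List.mem_ofFn, Function.comp_apply] at hw
      obtain ⟨i, rfl⟩ := hw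
      have : h (commBar (xx i) (yy i)) = commBar (h (xx i)) (h (yy i)) := by
        simp only [commBar, map_mul, map_inv]
      rw [this, Heis.commBar_eq, hcomm, hcomm]
      ext <;> simp
    · exact congrArg Multiplicative.toAdd (DFunLike.congr_fun hA (φ (FreeGroup.of n)))
    · have h1 := congrArg Multiplicative.toAdd (DFunLike.congr_fun hB (φ (FreeGroup.of n)))
      have h2 : f0 (φ (FreeGroup.of n)) = h (FreeGroup.of n) := by
        change h (φ⁻¹ (φ (FreeGroup.of n))) = _
        rw [MulAut.inv_apply_self]
      change (f1 (φ (FreeGroup.of n))).b = _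
      refine Eq.trans h1 ?_
      change (f0 (φ (FreeGroup.of n))).b = _
      rw [h2]
      by_cases hn : n = m' <;> simp [h, hn]
  have hfin : ∀ (f : F g 0 →* Heis) (i : Fin g), f (surfaceWord g 0) = 1 →
      (∀ j, j ≠ i → (f (xx j)).b = 0 ∧ (f (yy j)).b = 0) →
      (f (xx i)).a * (f (yy i)).b - (f (yy i)).a * (f (xx i)).b = 0 := by
    intro f i h1 hj
    have hcb : ∀ j, f (commBar (xx j) (yy j)) = commBar (f (xx j)) (f (yy j)) := fun j => by
      simp only [commBar, map_mul, map_inv]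
    rw [surfaceWord_zero, map_list_prod, List.map_ofFn, prod_ofFn_single _ _ i, Function.comp_apply,
      hcb, Heis.commBar_eq] at h1
    · exact congrArg Heis.c h1
    · intro j hji
      rw [Function.comp_apply, hcb, Heis.commBar_eq, (hj j hji).1, (hj j hji).2]
      ext <;> simp
  revert hm
  -- Taking for m' the partner of m in its handle, the central coordinate of the image of the
  -- surface word is ± the exponent α(φ(m)), so this must vanish.
  refine Gen.cases0 (P := fun m => α (φ (FreeGroup.of m)) ≠ 1 → False) ?_ ?_ m
  · intro i hm
    obtain ⟨f, h1, h2⟩ := key (Gen.y i)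
    have := hfin f i h1 fun j hj => ⟨by simp [xx, h2], by simp [yy, h2, hj]⟩
    simp only [xx, yy, h2] at this
    simp at this
    exact hm this
  · intro i hm
    obtain ⟨f, h1, h2⟩ := key (Gen.x i)
    have := hfin f i h1 fun j hj => ⟨by simp [xx, h2, hj], by simp [yy, h2]⟩
    simp only [xx, yy, h2] at this
    simp at this
    exact hm this

end SurfaceWord

/-! ### Signed permutations of a basis -/

section SignedPermutation

variable {α : Type*}

/-- A signed permutation of the basis extends to an automorphism. -/
theorem exists_aut_signedPerm (σ : α → α × Bool) (hσ : Function.Bijective fun x => (σ x).1) :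
    ∃ χ : MulAut (FreeGroup α), ∀ x, χ (FreeGroup.of x) = lt (σ x) := by
  -- `s` only changes signs of basis elements, so it is its own inverse; it is applied after the
  -- underlying permutation.
  let s : FreeGroup α →* FreeGroup α :=
    FreeGroup.lift fun y => lt (y, (σ ((Equiv.ofBijective _ hσ).symm y)).2)
  have hs : ∀ y b, s (lt (y, b)) = lt (y, b == (σ ((Equiv.ofBijective _ hσ).symm y)).2) := by
    intro y b
    cases b
    · have h1 : s (FreeGroup.of y) = lt (y, (σ ((Equiv.ofBijective _ hσ).symm y)).2) := by simp [s]
      rw [lt_false, map_inv, h1, ← lt_bar]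
      congr 1
      simp [bar]
    · simp [lt_true, s]
  have hss : s.comp s = MonoidHom.id _ := by
    ext y
    have h1 : s (FreeGroup.of y) = lt (y, (σ ((Equiv.ofBijective _ hσ).symm y)).2) := by simp [s]
    rw [MonoidHom.comp_apply, h1, hs, beq_self_eq_true, lt_true]
    rfl
  refine ⟨(FreeGroup.freeGroupCongr (Equiv.ofBijective _ hσ)).trans
    (MonoidHom.toMulEquiv s s hss hss), fun x => ?_⟩
  change s (FreeGroup.freeGroupCongr (Equiv.ofBijective _ hσ) (FreeGroup.of x)) = _
  rw [FreeGroup.freeGroupCongr_apply, FreeGroup.map.of, ← lt_true, hs]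
  simp

end SignedPermutation

/-! ### States and their standard position -/

section States

open FreeGroup

variable {g : ℕ}

theorem mem_A_iff {φ : MulAut (F g 0)} : φ ∈ A g 0 ↔ φ (surfaceWord g 0) = surfaceWord g 0 := by
  refine ⟨fun h => h.1, fun h => ⟨h, ?_⟩⟩
  have : tClasses g 0 = ∅ := Set.range_eq_empty _
  rw [this, Set.image_empty]

/-- The surface word as a list of signed letters. -/
def surfaceList (g : ℕ) : List (Gen g 0 × Bool) :=
  (List.ofFn fun i : Fin g =>
    [(Gen.x i, false), (Gen.y i, false), (Gen.x i, true), (Gen.y i, true)]).flatten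

theorem mk_surfaceList : FreeGroup.mk (surfaceList g) = surfaceWord g 0 := by
  rw [mk_eq_prod, surfaceList, surfaceWord_zero, List.map_flatten, List.prod_flatten, List.map_map,
    List.map_ofFn]
  congr 2

theorem mem_surfaceList (l : Gen g 0 × Bool) : l ∈ surfaceList g := by
  obtain ⟨m, b⟩ := l
  rw [surfaceList, List.mem_flatten]
  refine Gen.cases0 (P := fun m => ∃ L ∈ _, (m, b) ∈ L) (fun i => ?_) (fun i => ?_) m <;>
  · refine ⟨_, List.mem_ofFn.2 ⟨i, rfl⟩, ?_⟩
    cases b <;> simp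

theorem nodup_surfaceList : (surfaceList g).Nodup := by
  rw [surfaceList, List.nodup_flatten]
  refine ⟨?_, ?_⟩
  · simp only [List.mem_ofFn]
    rintro _ ⟨i, rfl⟩
    simp
  · rw [List.pairwise_ofFn]
    intro i j hij
    have := hij.ne
    simp [this.symm]

/-- `V` contains each signed letter once, and `φ` sends it to the surface word. -/
structure IsState (V : List (Gen g 0 × Bool)) (φ : MulAut (F g 0)) : Prop where
  nodup : V.Nodup
  mem : ∀ l, l ∈ V
  map : φ (FreeGroup.mk V) = surfaceWord g 0

theorem IsState.not_mem_off {V : List (Gen g 0 × Bool)} {φ : MulAut (F g 0)} (h : IsState V φ)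
    (θ : MulAut (F g 0)) (x : Gen g 0) : θ (FreeGroup.mk V) ∉ off {x} := by
  have := apply_surfaceWord_not_mem_off (θ * φ⁻¹) x
  rwa [← h.map, MulAut.mul_apply, MulAut.inv_apply_self] at this

theorem mk_mem_off {α : Type*} {X : Set α} {L : List (α × Bool)} (h : ∀ l ∈ L, l.1 ∉ X) :
    FreeGroup.mk L ∈ off X := by
  rw [mk_eq_prod]
  refine Subgroup.list_prod_mem _ fun w hw => ?_
  obtain ⟨l, hl, rfl⟩ := List.mem_map.1 hw
  exact lt_mem_off (h l hl)

theorem mk_cons' {α : Type*} (l : α × Bool) (L : List (α × Bool)) : FreeGroup.mk (l :: L) = lt l * FreeGroup.mk L := by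
  rw [mk_eq_prod, mk_eq_prod, List.map_cons, List.prod_cons]

theorem mk_append' {α : Type*} (L M : List (α × Bool)) : FreeGroup.mk (L ++ M) = FreeGroup.mk L * FreeGroup.mk M := mul_mk.symm

theorem val_map_some {α : Type*} (K : FreeGroup α) (L : List (α × Bool)) :
    val K (L.map some) = FreeGroup.mk L := by
  rw [mk_eq_prod, val, List.map_map]
  rfl

instance : Finite (Gen g 0) :=
  Finite.of_surjective (Sum.elim Gen.x Gen.y : Fin g ⊕ Fin g → Gen g 0) fun m =>
    Gen.cases0 (P := fun m => ∃ s, Sum.elim Gen.x Gen.y s = m) (fun i => ⟨Sum.inl i, rfl⟩)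
      (fun i => ⟨Sum.inr i, rfl⟩) m

theorem length_of_nodup_of_mem {L : List (Gen g 0)} (hn : L.Nodup) (hm : ∀ m, m ∈ L) :
    L.length = 2 * g := by
  have hp : L.Perm (List.ofFn Gen.x ++ List.ofFn Gen.y) := by
    refine (List.perm_ext_iff_of_nodup hn ?_).2 fun m => ?_
    · refine List.Nodup.append (List.nodup_ofFn.2 fun i j h => by simpa using h)
        (List.nodup_ofFn.2 fun i j h => by simpa using h) ?_
      intro m h1 h2
      obtain ⟨i, rfl⟩ := List.mem_ofFn.1 h1
      obtain ⟨j, hj⟩ := List.mem_ofFn.1 h2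
      cases hj
    · refine iff_of_true (hm m) ?_
      refine Gen.cases0 (P := fun m => m ∈ _) (fun i => ?_) (fun i => ?_) m <;> simp [List.mem_ofFn]
  rw [hp.length_eq]
  simp
  omega

/-- Otherwise P would be closed under inversion, and conjugating its letters by a would turn a P ā Q
into P Q, which omits a. -/
theorem IsState.exists_linked {a : Gen g 0 × Bool} {P Q : List (Gen g 0 × Bool)}
    {φ : MulAut (F g 0)} (h : IsState (a :: (P ++ bar a :: Q)) φ) : ∃ b ∈ P, bar b ∈ Q := by
  by_contra! hcon
  obtain ⟨hnd, hne, hPQ⟩ := nodup_collapse (A := []) h.nodup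
  simp only [List.nil_append] at hnd hne hPQ
  have ha : ∀ l ∈ P ++ Q, l.1 ≠ a.1 := by
    intro l hl hh
    rcases eq_or_eq_bar hh with rfl | rfl
    · exact (hne _ hl).1 rfl
    · exact (hne _ hl).2 rfl
  have hbar : ∀ b ∈ P, bar b ∈ P := by
    intro b hb
    have h1 := h.mem (bar b)
    have h2 : (bar b).1 ≠ a.1 := ha b (by simp [hb])
    have h3 : bar b ≠ a := fun hh => h2 (by rw [hh])
    have h4 : bar b ≠ bar a := fun hh => h2 (by rw [hh]; rfl)
    have h5 := hcon b hb
    simp only [List.mem_cons, List.mem_append, h3, h4, h5, false_or, or_false] at h1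
    exact h1
  have hsgn : ∀ l : Gen g 0 × Bool, (l.1, true) ∈ P ↔ l ∈ P := by
    rintro ⟨y, b⟩
    cases b
    · exact ⟨fun hl => hbar _ hl, fun hl => hbar _ hl⟩
    · rfl
  obtain ⟨θ, h1, h2⟩ := exists_aut_conj {y : Gen g 0 | (y, true) ∈ P} (c := lt a)
    (lt_mem_off fun hh => ha _ (List.mem_append_left _ ((hsgn a).1 hh)) rfl)
  have hP : ∀ L, (∀ l ∈ L, l ∈ P) → θ (FreeGroup.mk L) = (lt a)⁻¹ * FreeGroup.mk L * lt a := by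
    intro L hL
    induction L with
    | nil => simp [← one_eq_mk]
    | cons l L ih =>
      rw [mk_cons', _root_.map_mul, ih fun m hm => hL m (by simp [hm]),
        h2 l ((hsgn l).2 (hL l (by simp)))]
      group
  refine h.not_mem_off θ a.1 ?_
  have hQ : θ (FreeGroup.mk Q) = FreeGroup.mk Q := h1.apply_of_mem (mk_mem_off fun l hl hh =>
    (hPQ l ((hsgn l).1 hh)).2 hl)
  have haa : θ (lt a) = lt a := h1.apply_lt fun hh =>
    ha _ (List.mem_append_left _ ((hsgn a).1 hh)) rfl
  have : θ (FreeGroup.mk (a :: (P ++ bar a :: Q))) = FreeGroup.mk P * FreeGroup.mk Q := by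
    simp only [mk_cons', mk_append', _root_.map_mul, lt_bar, _root_.map_inv, hP P fun _ h => h, hQ,
      haa]
    group
  rw [this]
  exact mul_mem (mk_mem_off fun l hl => ha l (by simp [hl])) (mk_mem_off fun l hl => ha l (by simp [hl]))

theorem exists_aut_of_pairs {L : List ((Gen g 0 × Bool) × (Gen g 0 × Bool))} (hL : L.length = g)
    (hm : ∀ m, m ∈ pairNames L) :
    ∃ χ : MulAut (F g 0), χ (surfaceWord g 0) = commProd L ∧
      ∀ (i : ℕ) (hi : i < g), χ (xx ⟨i, hi⟩) = lt (L[i]'(hL.symm ▸ hi)).1 ∧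
        χ (yy ⟨i, hi⟩) = lt (L[i]'(hL.symm ▸ hi)).2 := by
  let σ : Gen g 0 → Gen g 0 × Bool := fun m =>
    match m with
    | Gen.t j => j.elim0
    | Gen.x i => (L[(i : ℕ)]'(hL.symm ▸ i.2)).1
    | Gen.y i => (L[(i : ℕ)]'(hL.symm ▸ i.2)).2
  have hσ : Function.Bijective fun m => (σ m).1 := by
    rw [← Finite.surjective_iff_bijective]
    intro m
    obtain ⟨p, hp, hmp⟩ := List.mem_flatMap.1 (hm m)
    obtain ⟨i, hi, rfl⟩ := List.mem_iff_getElem.1 hp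
    simp only [List.mem_cons, List.not_mem_nil, or_false] at hmp
    rcases hmp with rfl | rfl
    · exact ⟨Gen.x ⟨i, hL ▸ hi⟩, rfl⟩
    · exact ⟨Gen.y ⟨i, hL ▸ hi⟩, rfl⟩
  obtain ⟨χ, hχ⟩ := exists_aut_signedPerm σ hσ
  refine ⟨χ, ?_, fun i hi => ⟨hχ _, hχ _⟩⟩
  rw [surfaceWord_zero, map_list_prod, List.map_ofFn, commProd]
  congr 1
  refine List.ext_getElem (by simp [hL]) fun i h1 h2 => ?_
  simp only [List.getElem_ofFn, List.getElem_map, Function.comp_apply, commBar, _root_.map_mul,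
    _root_.map_inv, xx, yy, hχ]
  rfl

/-- The first letter and the prefix of the word that ends with its inverse are in standard
position. -/
theorem IsState.exists_mem_A {a : Gen g 0 × Bool} {P Q : List (Gen g 0 × Bool)}
    {φ : MulAut (F g 0)} (h : IsState (a :: (P ++ bar a :: Q)) φ) (hg : 0 < g) :
    ∃ ψ ∈ A g 0, ψ (xx ⟨0, hg⟩)⁻¹ = φ (lt a) ∧
      ψ ((xx ⟨0, hg⟩)⁻¹ * (yy ⟨0, hg⟩)⁻¹ * xx ⟨0, hg⟩) = φ (lt a * FreeGroup.mk P * (lt a)⁻¹) := by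
  classical
  obtain ⟨b, hbP, hbQ⟩ := h.exists_linked
  obtain ⟨S, T, rfl⟩ := List.append_of_mem hbP
  obtain ⟨Q1, Q2, rfl⟩ := List.append_of_mem hbQ
  obtain ⟨hnd, hne⟩ := nodup_handle (A := []) (B := S) (d := a) (f := b) (C := T) (D := Q1) (E := Q2)
    (d' := bar a) (f' := bar b) (by simpa using h.nodup)
  simp only [List.nil_append] at hnd hne
  have hab : a.1 ≠ b.1 := by
    intro hh
    have hn := h.nodup
    rcases eq_or_eq_bar hh with rfl | rfl <;> simp at hn
  have hne' : ∀ l ∈ Q1 ++ T ++ S ++ Q2, l.1 ≠ a.1 ∧ l.1 ≠ b.1 := by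
    intro l hl
    obtain ⟨h1, h2, h3, h4⟩ := hne l hl
    refine ⟨fun hh => ?_, fun hh => ?_⟩ <;> rcases eq_or_eq_bar hh with hh | hh <;> contradiction
  have hmem : ∀ l, l ∈ Q1 ++ T ++ S ++ Q2 ↔ l.1 ≠ a.1 ∧ l.1 ≠ b.1 := by
    refine fun l => ⟨hne' l, fun hl => ?_⟩
    have h0 := h.mem l
    have h1 : l ≠ a := fun hh => hl.1 (by rw [hh])
    have h2 : l ≠ b := fun hh => hl.2 (by rw [hh])
    have h3 : l ≠ bar a := fun hh => hl.1 (by rw [hh]; rfl)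
    have h4 : l ≠ bar b := fun hh => hl.2 (by rw [hh]; rfl)
    simp only [List.mem_cons, List.mem_append, h1, h2, h3, h4, false_or] at h0 ⊢
    tauto
  have hoffb : ∀ L : List (Gen g 0 × Bool), (∀ l ∈ L, l ∈ Q1 ++ T ++ S ++ Q2) →
      FreeGroup.mk L ∈ off {b.1} := fun L hL => mk_mem_off fun l hl => (hne' l (hL l hl)).2
  have sS : ∀ l ∈ S, l ∈ Q1 ++ T ++ S ++ Q2 := by simp +contextual
  have sT : ∀ l ∈ T, l ∈ Q1 ++ T ++ S ++ Q2 := by simp +contextual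
  have sQ1 : ∀ l ∈ Q1, l ∈ Q1 ++ T ++ S ++ Q2 := by simp +contextual
  have sQ2 : ∀ l ∈ Q2, l ∈ Q1 ++ T ++ S ++ Q2 := by simp +contextual
  -- This turns the prefix a S b T ā into a b ā and the rest into Q1 T b̄ S Q2. The rest is then
  -- normalized with b̄ as the constant, so that a and b stay fixed.
  obtain ⟨θ, hθ, hθb⟩ := exists_aut_letter b (u := (FreeGroup.mk S)⁻¹) (v := (FreeGroup.mk T)⁻¹)
    (inv_mem (hoffb S sS)) (inv_mem (hoffb T sT))
  have hθL : ∀ L : List (Gen g 0 × Bool), (∀ l ∈ L, l ∈ Q1 ++ T ++ S ++ Q2) → θ (FreeGroup.mk L) = FreeGroup.mk L :=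
    fun L hL => hθ.apply_of_mem (hoffb L hL)
  have hθa : θ (lt a) = lt a := hθ.apply_lt hab
  set X : Finset (Gen g 0) := (((Q1 ++ T ++ S ++ Q2).map Prod.fst).toFinset) with hX
  have hXmem : ∀ y, y ∈ X ↔ y ≠ a.1 ∧ y ≠ b.1 := by
    intro y
    simp only [hX, List.mem_toFinset, List.mem_map]
    constructor
    · rintro ⟨l, hl, rfl⟩
      exact hne' l hl
    · intro hy
      exact ⟨(y, true), (hmem _).2 hy, rfl⟩
  have hword : IsWord X ((Q1 ++ T).map some ++ none :: (S ++ Q2).map some) := by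
    refine ⟨?_, by simp, fun l => ?_⟩
    · rw [List.nodup_middle, List.nodup_cons, ← List.map_append, ← List.append_assoc]
      exact ⟨by simp, hnd.map (Option.some_injective _)⟩
    · rw [hXmem, ← hmem]
      simp
  have hbX : lt (bar b) ∈ off (X : Set (Gen g 0)) := lt_mem_off (by simp [hXmem])
  obtain ⟨θ', hθ', w, R, hRn, hRX, hR⟩ := exists_aut_hasNF X.card X rfl _ (lt (bar b)) hword hbX
  have hθa' : θ' (lt a) = lt a := hθ'.apply_lt (by simp [hXmem])
  have hθb' : θ' (lt b) = lt b := hθ'.apply_lt (by simp [hXmem])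
  have hprefix : (θ' * θ) (lt a * FreeGroup.mk (S ++ b :: T) * (lt a)⁻¹) = lt a * lt b * (lt a)⁻¹ := by
    have : θ (lt a * FreeGroup.mk (S ++ b :: T) * (lt a)⁻¹) = lt a * lt b * (lt a)⁻¹ := by
      simp only [mk_append', mk_cons', _root_.map_mul, _root_.map_inv, hθa, hθb, hθL S sS, hθL T sT]
      group
    rw [MulAut.mul_apply, this, _root_.map_mul, _root_.map_mul, _root_.map_inv, hθa', hθb']
  have hall : (θ' * θ) (FreeGroup.mk (a :: (S ++ b :: T ++ bar a :: (Q1 ++ bar b :: Q2)))) =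
      lt a * lt b * (lt a)⁻¹ * (ev 1 w * lt (bar b) * (ev 1 w)⁻¹ * commProd R) := by
    have h1 : FreeGroup.mk (a :: (S ++ b :: T ++ bar a :: (Q1 ++ bar b :: Q2))) =
        lt a * FreeGroup.mk (S ++ b :: T) * (lt a)⁻¹ * (FreeGroup.mk Q1 * (lt b)⁻¹ * FreeGroup.mk Q2) := by
      simp only [mk_cons', mk_append', mul_assoc, lt_bar]
    have h2 : θ (FreeGroup.mk Q1 * (lt b)⁻¹ * FreeGroup.mk Q2) =
        val (lt (bar b)) ((Q1 ++ T).map some ++ none :: (S ++ Q2).map some) := by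
      rw [val_append, val_cons, val_map_some, val_map_some]
      simp only [_root_.map_mul, _root_.map_inv, hθb, hθL Q1 sQ1, hθL Q2 sQ2, mk_append',
        ev_none, lt_bar]
      group
    rw [h1, _root_.map_mul, hprefix, MulAut.mul_apply, h2, hR]
  -- A missing basis element would contradict `IsState.not_mem_off`.
  have hused : ∀ y, y ∈ a.1 :: b.1 :: ((w.map Prod.fst).toList ++ pairNames R) := by
    intro y
    by_contra hy
    simp only [List.mem_cons, List.mem_append, not_or] at hy
    obtain ⟨hya, hyb, hyw, hyR⟩ := hy
    refine h.not_mem_off (θ' * θ) y ?_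
    rw [hall]
    have ma : lt a ∈ off {y} := lt_mem_off fun hh => hya hh.symm
    have mb : lt b ∈ off {y} := lt_mem_off fun hh => hyb hh.symm
    have mw : ev 1 w ∈ off {y} := by
      cases w with
      | none => exact one_mem _
      | some l => exact lt_mem_off fun hh => hyw (by simpa using hh.symm)
    have mR : commProd R ∈ off {y} := commProd_mem_off fun x hx hh => hyR (by
      rw [← Set.mem_singleton_iff.1 hh]; exact hx)
    rw [lt_bar]
    exact mul_mem (mul_mem (mul_mem ma mb) (inv_mem ma))
      (mul_mem (mul_mem (mul_mem mw (inv_mem mb)) (inv_mem mw)) mR)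
  have hlen := length_of_nodup_of_mem (g := g)
    (L := a.1 :: b.1 :: ((w.map Prod.fst).toList ++ pairNames R)) (by
      refine List.nodup_cons.2 ⟨?_, List.nodup_cons.2 ⟨?_, hRn⟩⟩
      · intro hh
        rcases List.mem_cons.1 hh with hh | hh
        · exact hab hh
        · exact ((hXmem _).1 (hRX _ hh)).1 rfl
      · intro hh
        exact ((hXmem _).1 (hRX _ hh)).2 rfl) hused
  have hlenR : (pairNames R).length = 2 * R.length := by
    simp [pairNames, List.length_flatMap]
    omega
  -- Parity: there are 2g basis elements, and a, b and the pairs of R account for an even number, so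
  -- w cannot be a letter. The word is thus [ā, b̄] times the commutators of R.
  cases w with
  | some l =>
    simp [hlenR] at hlen
    omega
  | none =>
    simp only [Option.map_none, Option.toList_none, List.nil_append, List.length_cons, hlenR] at hlen
    obtain ⟨χ, hχ, hχ'⟩ := exists_aut_of_pairs (L := (bar a, bar b) :: R) (by simp; omega) (by
      simpa [pairNames] using hused)
    obtain ⟨hx, hy⟩ := hχ' 0 hg
    simp only [List.getElem_cons_zero] at hx hy
    have hinv : ∀ u v, (θ' * θ) u = v → (θ' * θ)⁻¹ v = u := by
      rintro u _ rfl
      exact MulAut.inv_apply_self _ _ _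
    refine ⟨φ * (θ' * θ)⁻¹ * χ, mem_A_iff.2 ?_, ?_, ?_⟩
    · rw [MulAut.mul_apply, MulAut.mul_apply, hχ, hinv _ _ ?_, h.map]
      rw [hall]
      simp [commProd, commBar, ev, mul_assoc]
    · rw [MulAut.mul_apply, MulAut.mul_apply, _root_.map_inv χ, hx, lt_bar, inv_inv, hinv _ _ ?_]
      rw [MulAut.mul_apply, hθa, hθa']
    · rw [MulAut.mul_apply, MulAut.mul_apply, _root_.map_mul χ, _root_.map_mul χ, _root_.map_inv χ,
        _root_.map_inv χ, hx, hy, lt_bar, lt_bar, inv_inv, inv_inv, hinv _ _ hprefix]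

end States

/-! ### The orbit of x̄₁ȳ₁x₁ and its behaviour under Nielsen moves -/

section Orbit

open FreeGroup

variable {g : ℕ}

theorem IsState.letter {V V' : List (Gen g 0 × Bool)} {φ τ : MulAut (F g 0)} (h : IsState V φ)
    (hp : V'.Perm V) (hτ : τ (FreeGroup.mk V') = FreeGroup.mk V) : IsState V' (φ * τ) :=
  ⟨hp.nodup_iff.2 h.nodup, fun l => hp.mem_iff.2 (h.mem l), by rw [MulAut.mul_apply, hτ, h.map]⟩

theorem fst_ne_of_ne {α : Type*} {c l : α × Bool} (h1 : l ≠ c)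
    (h2 : l ≠ bar c) : l.1 ≠ c.1 := by
  intro h
  rcases eq_or_eq_bar h with h | h
  · exact h1 h
  · exact h2 h

theorem FixesOff.mk_eq {α : Type*} {c : α} {τ : MulAut (FreeGroup α)} (h : FixesOff {c} τ)
    {L : List (α × Bool)} (hL : ∀ l ∈ L, l.1 ≠ c) : τ (FreeGroup.mk L) = FreeGroup.mk L :=
  h.apply_of_mem (mk_mem_off hL)

/-- Consecutive letters of a state are not inverse to each other. -/
theorem IsState.fst_ne {X Y : List (Gen g 0 × Bool)} {c d : Gen g 0 × Bool} {φ : MulAut (F g 0)}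
    (h : IsState (X ++ c :: d :: Y) φ) : c.1 ≠ d.1 := by
  intro hcd
  have hn := h.nodup
  rcases eq_or_eq_bar hcd with rfl | rfl
  · rw [List.nodup_middle] at hn
    simp at hn
  · refine h.not_mem_off 1 d.1 ?_
    have : FreeGroup.mk (X ++ bar d :: d :: Y) = FreeGroup.mk (X ++ Y) := by
      simp only [mk_append', mk_cons', lt_bar]
      group
    rw [MulAut.one_apply, this]
    obtain ⟨-, hne, -⟩ := nodup_collapse (B := []) hn
    refine mk_mem_off fun l hl => fst_ne_of_ne ?_ ?_
    · exact (hne l (by simpa using hl)).2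
    · exact (hne l (by simpa using hl)).1

/-- The two cases for the position of the inverse of a letter. -/
theorem IsState.bar_mem {X Y : List (Gen g 0 × Bool)} {c : Gen g 0 × Bool} {φ : MulAut (F g 0)}
    (h : IsState (X ++ c :: Y) φ) :
    (∃ X₁ X₂, X = X₁ ++ bar c :: X₂) ∨ ∃ Y₁ Y₂, Y = Y₁ ++ bar c :: Y₂ := by
  have := h.mem (bar c)
  rw [List.mem_append, List.mem_cons] at this
  rcases this with h | h | h
  · exact Or.inl (List.append_of_mem h)
  · exact absurd h (bar_ne c)
  · exact Or.inr (List.append_of_mem h)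

/-- The Nielsen move that replaces `c` by `c d`. -/
theorem exists_left_move {α : Type*} {c d : α × Bool} (hcd : c.1 ≠ d.1)
    (φ : MulAut (FreeGroup α)) :
    ∃ τ : MulAut (FreeGroup α), FixesOff {c.1} τ ∧ τ (lt c) = lt c * lt d ∧
      (φ * τ) (lt c) = φ (lt c) * φ (lt d) ∧ ∀ l, l.1 ≠ c.1 → (φ * τ) (lt l) = φ (lt l) := by
  obtain ⟨τ, h1, h2⟩ := exists_aut_letter c (u := 1) (v := lt d) (one_mem _)
    (lt_mem_off hcd.symm)
  rw [one_mul] at h2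
  exact ⟨τ, h1, h2, by rw [MulAut.mul_apply, h2, _root_.map_mul],
    fun l hl => by rw [MulAut.mul_apply, h1.apply_lt hl]⟩

/-- The Nielsen move that replaces `d` by `c d`. -/
theorem exists_right_move {α : Type*} {c d : α × Bool} (hcd : c.1 ≠ d.1)
    (φ : MulAut (FreeGroup α)) :
    ∃ τ : MulAut (FreeGroup α), FixesOff {d.1} τ ∧ τ (lt d) = lt c * lt d ∧
      (φ * τ) (lt d) = φ (lt c) * φ (lt d) ∧ ∀ l, l.1 ≠ d.1 → (φ * τ) (lt l) = φ (lt l) := by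
  obtain ⟨τ, h1, h2⟩ := exists_aut_letter d (u := lt c) (v := 1) (lt_mem_off hcd) (one_mem _)
  rw [mul_one] at h2
  exact ⟨τ, h1, h2, by rw [MulAut.mul_apply, h2, _root_.map_mul],
    fun l hl => by rw [MulAut.mul_apply, h1.apply_lt hl]⟩

/-- The element `x₁⁻¹ y₁⁻¹ x₁`. -/
def zz (hg : 0 < g) : F g 0 := (xx ⟨0, hg⟩)⁻¹ * (yy ⟨0, hg⟩)⁻¹ * xx ⟨0, hg⟩

/-- The subgroup generated by the stabilizer of `x₁⁻¹ y₁⁻¹ x₁` and `β₁`. -/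
def genSub (hg : 0 < g) : Subgroup (MulAut (F g 0)) :=
  Subgroup.closure ({φ | φ ∈ A g 0 ∧ φ (zz hg) = zz hg} ∪ {beta ⟨0, hg⟩})

theorem apply_surfaceWord_of_commBar {φ : MulAut (F g 0)}
    (h : ∀ i, φ (commBar (xx i) (yy i)) = commBar (xx i) (yy i)) : φ ∈ A g 0 := by
  rw [mem_A_iff, surfaceWord_zero, map_list_prod, List.map_ofFn]
  congr 2
  funext i
  exact h i

theorem beta_apply_xx (i j : Fin g) : (beta i : MulAut (F g 0)) (xx j) = xx j := by
  change mulY i (xx i) (xx j) = xx j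
  simp [mulY, xx]

theorem beta_apply_yy (i : Fin g) : (beta i : MulAut (F g 0)) (yy i) = xx i * yy i := by
  change mulY i (xx i) (yy i) = xx i * yy i
  simp [mulY, yy]

theorem beta_apply_yy_of_ne {i j : Fin g} (h : j ≠ i) :
    (beta i : MulAut (F g 0)) (yy j) = yy j := by
  change mulY i (xx i) (yy j) = yy j
  simp [mulY, yy, h]

theorem beta_mem_A (i : Fin g) : (beta i : MulAut (F g 0)) ∈ A g 0 := by
  refine apply_surfaceWord_of_commBar fun j => ?_
  simp only [commBar, _root_.map_mul, _root_.map_inv, beta_apply_xx]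
  by_cases h : j = i
  · subst h
    rw [beta_apply_yy]
    group
  · rw [beta_apply_yy_of_ne h]

theorem genSub_le (hg : 0 < g) : genSub hg ≤ A g 0 := by
  rw [genSub, Subgroup.closure_le]
  rintro φ (h | h)
  · exact h.1
  · rw [Set.mem_singleton_iff.1 h]
    exact beta_mem_A _

theorem mem_genSub_of_apply (hg : 0 < g) {φ γ : MulAut (F g 0)} (hφ : φ ∈ A g 0)
    (hγ : γ ∈ genSub hg) (h : φ (zz hg) = γ (zz hg)) : φ ∈ genSub hg := by
  have : γ⁻¹ * φ ∈ genSub hg := Subgroup.subset_closure (Or.inl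
    ⟨mul_mem (inv_mem (genSub_le hg hγ)) hφ, by
      rw [MulAut.mul_apply, h, MulAut.inv_apply_self]⟩)
  simpa using mul_mem hγ this

/-- The automorphism θ : x₁ ↦ ȳ₁x₁ fixes [x₁, y₁] and x̄₁ȳ₁x₁. Now β₁ sends x̄₁ȳ₁x₁ to x̄₁ȳ₁, and θ
sends this to x̄₁. -/
theorem exists_apply_zz (hg : 0 < g) : ∃ γ ∈ genSub hg, γ (zz hg) = (xx ⟨0, hg⟩)⁻¹ := by
  obtain ⟨θ, h1, h2⟩ := exists_aut_letter ((Gen.x ⟨0, hg⟩, true) : Gen g 0 × Bool)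
    (u := (yy ⟨0, hg⟩)⁻¹) (v := 1) (inv_mem (of_mem_off (by simp))) (one_mem _)
  have hx : θ (xx ⟨0, hg⟩) = (yy ⟨0, hg⟩)⁻¹ * xx ⟨0, hg⟩ := by
    rw [mul_one] at h2
    exact h2
  have hy : ∀ j, θ (yy j) = yy j := fun j => h1 _ (by simp)
  have hx' : ∀ j, j ≠ ⟨0, hg⟩ → θ (xx j) = xx j := fun j hj => h1 _ (by simpa using hj)
  have hθ : θ ∈ genSub hg := by
    refine Subgroup.subset_closure (Or.inl ⟨apply_surfaceWord_of_commBar fun j => ?_, ?_⟩)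
    · simp only [commBar, _root_.map_mul, _root_.map_inv, hy]
      by_cases h : j = ⟨0, hg⟩
      · subst h
        rw [hx]
        group
      · rw [hx' j h]
    · simp only [zz, _root_.map_mul, _root_.map_inv, hy, hx]
      group
  refine ⟨θ * beta ⟨0, hg⟩, mul_mem hθ (Subgroup.subset_closure (Or.inr rfl)), ?_⟩
  simp only [zz, MulAut.mul_apply, _root_.map_mul, _root_.map_inv, beta_apply_xx, beta_apply_yy, hx,
    hy]
  group

/-- The orbit of `x₁⁻¹ y₁⁻¹ x₁`. -/
def InOrbit (hg : 0 < g) (u : F g 0) : Prop := ∃ γ ∈ genSub hg, γ (zz hg) = u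

/-- Both sides amount to ψ ∈ `genSub hg`. -/
theorem inOrbit_apply_iff (hg : 0 < g) {ψ : MulAut (F g 0)} (hψ : ψ ∈ A g 0) :
    InOrbit hg (ψ (xx ⟨0, hg⟩)⁻¹) ↔ InOrbit hg (ψ (zz hg)) := by
  obtain ⟨δ, hδ, hδz⟩ := exists_apply_zz hg
  constructor
  · rintro ⟨γ, hγ, h⟩
    have : ψ * δ ∈ genSub hg := mem_genSub_of_apply hg (mul_mem hψ (genSub_le hg hδ)) hγ (by
      rw [MulAut.mul_apply, hδz, h])
    exact ⟨ψ, by simpa using mul_mem this (inv_mem hδ), rfl⟩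
  · rintro ⟨γ, hγ, h⟩
    have : ψ ∈ genSub hg := mem_genSub_of_apply hg hψ hγ h.symm
    exact ⟨ψ * δ, mul_mem this hδ, by rw [MulAut.mul_apply, hδz]⟩

theorem IsState.inOrbit_prefix (hg : 0 < g) {a : Gen g 0 × Bool} {P Q : List (Gen g 0 × Bool)}
    {φ : MulAut (F g 0)} (h : IsState (a :: (P ++ bar a :: Q)) φ) :
    InOrbit hg (φ (lt a)) ↔ InOrbit hg (φ (lt a * FreeGroup.mk P * (lt a)⁻¹)) := by
  obtain ⟨ψ, hψ, h1, h2⟩ := h.exists_mem_A hg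
  rw [← h1, ← h2]
  exact inOrbit_apply_iff hg hψ

/-- The substitution a ↦ ab turns a b Y₁ ā Y₂ into the state a Y₁ b ā Y₂, whose first letter has
value φ(a)φ(b). The prefixes ending in ā have the same value in both states, so
`IsState.inOrbit_prefix` applies twice. -/
theorem IsState.inOrbit_mul (hg : 0 < g) {a b : Gen g 0 × Bool} {Y : List (Gen g 0 × Bool)}
    {φ : MulAut (F g 0)} (h : IsState (a :: b :: Y) φ) :
    InOrbit hg (φ (lt a)) ↔ InOrbit hg (φ (lt a) * φ (lt b)) := by
  have hab : a.1 ≠ b.1 := h.fst_ne (X := [])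
  obtain ⟨Y₁, Y₂, rfl⟩ : ∃ Y₁ Y₂, Y = Y₁ ++ bar a :: Y₂ := by
    refine List.append_of_mem ?_
    have := h.mem (bar a)
    rw [List.mem_cons, List.mem_cons] at this
    rcases this with h | h | h
    · exact absurd h (bar_ne a)
    · exact absurd (congrArg Prod.fst h) hab
    · exact h
  obtain ⟨τ, h1, h2, h3, h4⟩ := exists_left_move hab φ
  obtain ⟨-, hne, -⟩ := nodup_collapse (A := []) (m := a) (B := b :: Y₁) (m' := bar a) (C := Y₂)
    (by simpa using h.nodup)
  have hY : ∀ l ∈ Y₁ ++ Y₂, l.1 ≠ a.1 := by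
    intro l hl
    obtain ⟨h1, h2⟩ := hne l (by simp at hl ⊢; tauto)
    exact fst_ne_of_ne h1 h2
  have e1 : τ (FreeGroup.mk Y₁) = FreeGroup.mk Y₁ := h1.mk_eq fun l hl => hY l (by simp [hl])
  have e2 : τ (FreeGroup.mk Y₂) = FreeGroup.mk Y₂ := h1.mk_eq fun l hl => hY l (by simp [hl])
  have e3 : τ (lt b) = lt b := h1.apply_lt hab.symm
  have h' : IsState (a :: ((Y₁ ++ [b]) ++ bar a :: Y₂)) (φ * τ) := by
    refine h.letter ?_ ?_
    · refine List.Perm.cons a ?_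
      rw [List.append_assoc]
      exact List.perm_middle
    · simp only [mk_cons', mk_append', _root_.map_mul, lt_bar, _root_.map_inv, h2, e1, e2, e3,
        ← one_eq_mk, _root_.map_one]
      group
  rw [h.inOrbit_prefix hg (P := b :: Y₁), ← h3, h'.inOrbit_prefix hg]
  refine iff_of_eq (congrArg _ ?_)
  rw [MulAut.mul_apply]
  congr 1
  simp only [mk_cons', mk_append', _root_.map_mul, _root_.map_inv, h2, e1, e3, ← one_eq_mk,
    _root_.map_one]
  group

/-- The value of the first letter lies in the orbit. -/
def HeadInOrbit (hg : 0 < g) (V : List (Gen g 0 × Bool)) (φ : MulAut (F g 0)) : Prop :=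
  ∃ v V', V = v :: V' ∧ InOrbit hg (φ (lt v))

theorem headInOrbit_cons (hg : 0 < g) (v : Gen g 0 × Bool) (V : List (Gen g 0 × Bool))
    (φ : MulAut (F g 0)) : HeadInOrbit hg (v :: V) φ ↔ InOrbit hg (φ (lt v)) := by
  constructor
  · rintro ⟨_, _, h, h'⟩
    cases h
    exact h'
  · exact fun h => ⟨_, _, rfl, h⟩

/-- The substitution c ↦ cd is compensated by moving d from behind c to the place just before c̄.
The value of the first letter changes only if c or c̄ comes first, and `IsState.inOrbit_mul` covers
both cases. -/
theorem IsState.left_move (hg : 0 < g) {X Y : List (Gen g 0 × Bool)} {c d : Gen g 0 × Bool}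
    {φ : MulAut (F g 0)} (h : IsState (X ++ c :: d :: Y) φ) :
    ∃ V' φ', IsState V' φ' ∧ V'.Perm (X ++ c :: d :: Y) ∧ φ' (lt c) = φ (lt c) * φ (lt d) ∧
      (∀ l, l.1 ≠ c.1 → φ' (lt l) = φ (lt l)) ∧
      (HeadInOrbit hg V' φ' → HeadInOrbit hg (X ++ c :: d :: Y) φ) := by
  have hcd := h.fst_ne
  obtain ⟨τ, h1, h2, h3, h4⟩ := exists_left_move hcd φ
  have e3 : τ (lt d) = lt d := h1.apply_lt hcd.symm
  rcases h.bar_mem with ⟨X₁, X₂, rfl⟩ | ⟨Y₁, Y₂, hY⟩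
  · obtain ⟨-, hne, -⟩ := nodup_collapse (A := X₁) (m := bar c) (B := X₂) (m' := c) (C := d :: Y)
      (by simpa using h.nodup)
    have hX : ∀ l ∈ X₁ ++ X₂ ++ d :: Y, l.1 ≠ c.1 := fun l hl =>
      fst_ne_of_ne (hne l hl).2 (hne l hl).1
    have eX₁ := h1.mk_eq (L := X₁) fun l hl => hX l (by simp [hl])
    have eX₂ := h1.mk_eq (L := X₂) fun l hl => hX l (by simp [hl])
    have eY := h1.mk_eq (L := Y) fun l hl => hX l (by simp [hl])
    have hp : (X₁ ++ d :: bar c :: (X₂ ++ c :: Y)).Perm (X₁ ++ bar c :: X₂ ++ c :: d :: Y) := by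
      classical
      rw [List.perm_iff_count]
      intro l
      simp only [List.count_append, List.count_cons]
      omega
    have h' : IsState (X₁ ++ d :: bar c :: (X₂ ++ c :: Y)) (φ * τ) := by
      refine h.letter hp ?_
      simp only [mk_cons', mk_append', _root_.map_mul, lt_bar, _root_.map_inv, h2, eX₁, eX₂, e3, eY]
      group
    refine ⟨_, _, h', hp, h3, h4, ?_⟩
    cases X₁ with
    | nil =>
      simp only [List.nil_append, List.cons_append, headInOrbit_cons] at h' ⊢
      -- The new word begins with d c̄, and the product of their new values is φ(d)(φ(c)φ(d))⁻¹ =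
      -- φ(c̄), the value of the old first letter.
      rw [h'.inOrbit_mul hg]
      intro hh
      convert hh using 1
      rw [lt_bar, _root_.map_inv, _root_.map_inv, h3, h4 d hcd.symm]
      group
    | cons x X₁ =>
      simp only [List.cons_append, headInOrbit_cons]
      rw [h4 x (hX x (by simp))]
      exact id
  · obtain ⟨Y₁, rfl⟩ : ∃ Z, Y₁ = d :: Z := by
      cases Y₁ with
      | nil => exact absurd (congrArg Prod.fst (List.cons.inj hY).1).symm hcd
      | cons y Z => exact ⟨Z, by rw [(List.cons.inj hY).1]⟩
    obtain rfl : Y = Y₁ ++ bar c :: Y₂ := (List.cons.inj hY).2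
    obtain ⟨-, hne, -⟩ := nodup_collapse (A := X) (m := c) (B := d :: Y₁) (m' := bar c) (C := Y₂)
      (by simpa using h.nodup)
    have hX : ∀ l ∈ X ++ d :: Y₁ ++ Y₂, l.1 ≠ c.1 := fun l hl =>
      fst_ne_of_ne (hne l hl).1 (hne l hl).2
    have eX := h1.mk_eq (L := X) fun l hl => hX l (by simp [hl])
    have eY₁ := h1.mk_eq (L := Y₁) fun l hl => hX l (by simp [hl])
    have eY₂ := h1.mk_eq (L := Y₂) fun l hl => hX l (by simp [hl])
    have hp : (X ++ c :: (Y₁ ++ d :: bar c :: Y₂)).Perm (X ++ c :: d :: (Y₁ ++ bar c :: Y₂)) := by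
      classical
      rw [List.perm_iff_count]
      intro l
      simp only [List.count_append, List.count_cons]
      omega
    have h' : IsState (X ++ c :: (Y₁ ++ d :: bar c :: Y₂)) (φ * τ) := by
      refine h.letter hp ?_
      simp only [mk_cons', mk_append', _root_.map_mul, lt_bar, _root_.map_inv, h2, eX, eY₁, e3, eY₂]
      group
    refine ⟨_, _, h', hp, h3, h4, ?_⟩
    cases X with
    | nil =>
      simp only [List.nil_append, headInOrbit_cons] at h ⊢
      rw [h.inOrbit_mul hg, h3]
      exact id
    | cons x X =>
      simp only [List.cons_append, headInOrbit_cons]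
      rw [h4 x (hX x (by simp))]
      exact id

/-- Mirror image of the left move: for d ↦ cd, the letter c moves from before d to the place just
behind d̄. -/
theorem IsState.right_move (hg : 0 < g) {X Y : List (Gen g 0 × Bool)} {c d : Gen g 0 × Bool}
    {φ : MulAut (F g 0)} (h : IsState (X ++ c :: d :: Y) φ) :
    ∃ V' φ', IsState V' φ' ∧ V'.Perm (X ++ c :: d :: Y) ∧ φ' (lt d) = φ (lt c) * φ (lt d) ∧
      (∀ l, l.1 ≠ d.1 → φ' (lt l) = φ (lt l)) ∧
      (HeadInOrbit hg V' φ' → HeadInOrbit hg (X ++ c :: d :: Y) φ) := by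
  have hcd := h.fst_ne
  obtain ⟨τ, h1, h2, h3, h4⟩ := exists_right_move hcd φ
  have e3 : τ (lt c) = lt c := h1.apply_lt hcd
  have hbar : (∃ X₁ X₂, X = X₁ ++ bar d :: X₂) ∨ ∃ Y₁ Y₂, Y = Y₁ ++ bar d :: Y₂ := by
    have := h.mem (bar d)
    rw [List.mem_append, List.mem_cons, List.mem_cons] at this
    rcases this with h | h | h | h
    · exact Or.inl (List.append_of_mem h)
    · exact absurd (congrArg Prod.fst h).symm hcd
    · exact absurd h (bar_ne d)
    · exact Or.inr (List.append_of_mem h)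
  rcases hbar with ⟨X₁, X₂, rfl⟩ | ⟨Y₁, Y₂, rfl⟩
  · obtain ⟨-, hne, -⟩ := nodup_collapse (A := X₁) (m := bar d) (B := X₂ ++ [c]) (m' := d) (C := Y)
      (by simpa using h.nodup)
    have hX : ∀ l ∈ X₁ ++ (X₂ ++ [c]) ++ Y, l.1 ≠ d.1 := fun l hl =>
      fst_ne_of_ne (hne l hl).2 (hne l hl).1
    have eX₁ := h1.mk_eq (L := X₁) fun l hl => hX l (by simp [hl])
    have eX₂ := h1.mk_eq (L := X₂) fun l hl => hX l (by simp [hl])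
    have eY := h1.mk_eq (L := Y) fun l hl => hX l (by simp [hl])
    have hp : (X₁ ++ bar d :: c :: (X₂ ++ d :: Y)).Perm (X₁ ++ bar d :: X₂ ++ c :: d :: Y) := by
      classical
      rw [List.perm_iff_count]
      intro l
      simp only [List.count_append, List.count_cons]
      omega
    have h' : IsState (X₁ ++ bar d :: c :: (X₂ ++ d :: Y)) (φ * τ) := by
      refine h.letter hp ?_
      simp only [mk_cons', mk_append', _root_.map_mul, lt_bar, _root_.map_inv, h2, eX₁, eX₂, e3, eY]
      group
    refine ⟨_, _, h', hp, h3, h4, ?_⟩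
    cases X₁ with
    | nil =>
      simp only [List.nil_append, List.cons_append, headInOrbit_cons] at h' ⊢
      rw [h'.inOrbit_mul hg]
      intro hh
      convert hh using 1
      rw [lt_bar, _root_.map_inv, _root_.map_inv, h3, h4 c hcd]
      group
    | cons x X₁ =>
      simp only [List.cons_append, headInOrbit_cons]
      rw [h4 x (hX x (by simp))]
      exact id
  · obtain ⟨-, hne, -⟩ := nodup_collapse (A := X ++ [c]) (m := d) (B := Y₁) (m' := bar d) (C := Y₂)
      (by simpa using h.nodup)
    have hX : ∀ l ∈ X ++ [c] ++ Y₁ ++ Y₂, l.1 ≠ d.1 := fun l hl =>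
      fst_ne_of_ne (hne l hl).1 (hne l hl).2
    have eX := h1.mk_eq (L := X) fun l hl => hX l (by simp [hl])
    have eY₁ := h1.mk_eq (L := Y₁) fun l hl => hX l (by simp [hl])
    have eY₂ := h1.mk_eq (L := Y₂) fun l hl => hX l (by simp [hl])
    have hp : (X ++ d :: (Y₁ ++ bar d :: c :: Y₂)).Perm (X ++ c :: d :: (Y₁ ++ bar d :: Y₂)) := by
      classical
      rw [List.perm_iff_count]
      intro l
      simp only [List.count_append, List.count_cons]
      omega
    have h' : IsState (X ++ d :: (Y₁ ++ bar d :: c :: Y₂)) (φ * τ) := by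
      refine h.letter hp ?_
      simp only [mk_cons', mk_append', _root_.map_mul, lt_bar, _root_.map_inv, h2, eX, eY₁, e3, eY₂]
      group
    refine ⟨_, _, h', hp, h3, h4, ?_⟩
    cases X with
    | nil =>
      simp only [List.nil_append, headInOrbit_cons] at h ⊢
      rw [h.inOrbit_mul hg, h3]
      exact id
    | cons x X =>
      simp only [List.cons_append, headInOrbit_cons]
      rw [h4 x (hX x (by simp))]
      exact id

theorem surfaceList_succ (n : ℕ) : ∃ T, surfaceList (n + 1) =
    (Gen.x 0, false) :: (Gen.y 0, false) :: (Gen.x 0, true) :: (Gen.y 0, true) :: T := by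
  rw [surfaceList, List.ofFn_succ, List.flatten_cons]
  exact ⟨_, rfl⟩

theorem IsState.headInOrbit_of_isChain (hg : 0 < g) {N : WordRank (Gen g 0)}
    {V : List (Gen g 0 × Bool)} {φ : MulAut (F g 0)} (h : IsState V φ)
    (hch : List.IsChain (fun c d => Tight N (φ (lt c)) (φ (lt d))) V) : HeadInOrbit hg V φ := by
  obtain ⟨n, rfl⟩ : ∃ n, g = n + 1 := ⟨g - 1, by omega⟩
  obtain ⟨T, hT⟩ := surfaceList_succ n
  have hn := nodup_surfaceList (g := n + 1)
  have hm := mem_surfaceList (g := n + 1)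
  have hw := mk_surfaceList (g := n + 1)
  rw [hT] at hn hw
  simp only [hT] at hm
  obtain ⟨v, V', rfl, hv⟩ := apply_head_of_isChain_tight (a := (Gen.x 0, false))
    (b := (Gen.y 0, false)) h.nodup h.mem hn hm (h.map.trans hw.symm) hch
  refine ⟨v, V', rfl, ?_⟩
  rw [hv]
  exact exists_apply_zz hg

/-- Lexicographic induction on total length and total rank. The sums run over all signed letters, so
reordering the word does not affect them. -/
theorem IsState.headInOrbit (hg : 0 < g) (N : WordRank (Gen g 0)) (n : ℕ) :
    ∀ (m : ℕ) (V : List (Gen g 0 × Bool)) (φ : MulAut (F g 0)), IsState V φ →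
      totalLength V φ = n → totalRank N V φ = m → HeadInOrbit hg V φ := by
  induction n using Nat.strong_induction_on with
  | _ n ihn =>
  intro m
  induction m using Nat.strong_induction_on with
  | _ m ihm =>
  intro V φ h hlen hrank
  have finish : ∀ (V' : List (Gen g 0 × Bool)) (φ' : MulAut (F g 0)), IsState V' φ' → V'.Perm V →
      (totalLength V φ' < totalLength V φ ∨
        totalLength V φ' = totalLength V φ ∧ totalRank N V φ' < totalRank N V φ) →
      HeadInOrbit hg V' φ' := by
    intro V' φ' h' hp hdec
    have e1 : totalLength V' φ' = totalLength V φ' := (hp.map _).sum_eq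
    have e2 : totalRank N V' φ' = totalRank N V φ' := (hp.map _).sum_eq
    rcases hdec with hdec | ⟨hd1, hd2⟩
    · exact ihn _ (by omega) _ V' φ' h' rfl rfl
    · exact ihm _ (by omega) V' φ' h' (by omega) rfl
  by_cases hch : List.IsChain (fun c d => Tight N (φ (lt c)) (φ (lt d))) V
  · exact h.headInOrbit_of_isChain hg hch
  · rw [List.isChain_iff_forall_rel_of_append_cons_cons] at hch
    push Not at hch
    obtain ⟨c, d, X, Y, rfl, hnt⟩ := hch
    rcases (tight_or_gain N (apply_lt_ne_one φ c) (apply_lt_ne_one φ d)).resolve_left hnt with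
      hgain | hgain
    · obtain ⟨V', φ', h', hp, h1, h2, h3⟩ := h.right_move hg
      exact h3 (finish V' φ' h' hp (decrease_of_gain N h.nodup h.mem hgain h2 h1))
    · obtain ⟨V', φ', h', hp, h1, h2, h3⟩ := h.left_move hg
      -- A gain for the inverses means that the value of c̄ is improved by putting that of d̄ in
      -- front, so the decrease is applied to the letters d̄, c̄.
      rw [← _root_.map_inv, ← _root_.map_inv, ← lt_bar, ← lt_bar] at hgain
      refine h3 (finish V' φ' h' hp (decrease_of_gain N h.nodup h.mem hgain h2 ?_))
      simp only [lt_bar, _root_.map_inv, h1, mul_inv_rev]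

theorem genSub_eq (hg : 0 < g) : genSub hg = A g 0 := by
  refine le_antisymm (genSub_le hg) fun φ hφ => ?_
  obtain ⟨N⟩ := exists_wordRank (mem_surfaceList (g := g))
  have hs : IsState (surfaceList g) φ :=
    ⟨nodup_surfaceList, mem_surfaceList, by rw [mk_surfaceList]; exact mem_A_iff.1 hφ⟩
  obtain ⟨v, V', hV, γ, hγ, h⟩ := IsState.headInOrbit hg N _ _ _ φ hs rfl rfl
  have hv : lt v = (xx ⟨0, hg⟩)⁻¹ := by
    obtain ⟨n, rfl⟩ : ∃ n, g = n + 1 := ⟨g - 1, by omega⟩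
    obtain ⟨T, hT⟩ := surfaceList_succ n
    rw [hT] at hV
    rw [← (List.cons.inj hV).1]
    rfl
  obtain ⟨δ, hδ, hδz⟩ := exists_apply_zz hg
  have : φ * δ ∈ genSub hg := mem_genSub_of_apply hg (mul_mem hφ (genSub_le hg hδ)) hγ (by
    rw [MulAut.mul_apply, hδz, h, hv])
  simpa using mul_mem this (inv_mem hδ)

end Orbit

end ZieschangMCG

/-- For `g ≥ 1`, the group `A_{g,0}` is generated by `Stab(x_1⁻¹ y_1⁻¹ x_1; A_{g,0}) ∪ {β_1}`. -/
theorem theorem3p2 (g : ℕ) (hg : 1 ≤ g) :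
    Subgroup.closure
      ({φ : MulAut (ZieschangMCG.F g 0) | φ ∈ ZieschangMCG.A g 0 ∧
          φ ((ZieschangMCG.xx ⟨0, hg⟩)⁻¹ * (ZieschangMCG.yy ⟨0, hg⟩)⁻¹ * ZieschangMCG.xx ⟨0, hg⟩) =
            (ZieschangMCG.xx ⟨0, hg⟩)⁻¹ * (ZieschangMCG.yy ⟨0, hg⟩)⁻¹ * ZieschangMCG.xx ⟨0, hg⟩} ∪
        {ZieschangMCG.beta ⟨0, hg⟩}) = ZieschangMCG.A g 0 :=
  ZieschangMCG.genSub_eq hg
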